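/- Let $M$ be a loopless matroid on a finite set $E$. Write $\widehat{\mathcal L}(M)$ for its poset of proper non-empty flats. An order filter is a subset $\mathcal P\subseteq\widehat{\mathcal L}(M)$ closed under passing to larger elements of $\widehat{\mathcal L}(M)$. A set $I$ spans a flat $F$ if $I\subseteq F$ and $\mathrm{rk}(I)=\mathrm{rk}(F)$. For an order filter $\mathcal P$, the Bergman fan $\Sigma_{M,\mathcal P}$ in $\mathbb R^E/\mathbb R(1,\dots,1)$ consists of the cones $\sigma_{I<\mathcal F}$ generated by the vectors $e_i$ $(i\in I)$ and $e_F=\sum_{i\in F}e_i$ $(F\in\mathcal F)$, where $I\subseteq E$ spans no element of $\mathcal P\cup\{E\}$ and $\mathcal F\subseteq\mathcal P$ is a chain all of whose elements contain $I$. Its Stanley–Reisner ring $\mathbb C[\Sigma_{M,\mathcal P}]$ is the polynomial ring over $\mathbb C$ on the rays of the fan modulo the products $x_{\rho_1}\cdots x_{\rho_s}$ with $\mathrm{cone}(\rho_1,\dots,\rho_s)\notin\Sigma_{M,\mathcal P}$. Write $x_F$ for the variable of the ray of $e_F$ $(F\in\mathcal P)$, and $x_i$ for the variable of the ray $\sigma_{\{i\}<\emptyset}$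 if $\{i\}$ spans no element of $\mathcal P\cup\{E\}$, and $x_i=0$ otherwise. The ring $S_M=\mathbb C[t_i:i\in E]$ maps to $\mathbb C[\Sigma_{M,\mathcal P}]$ by $t_i\mapsto x_i+\sum_{i\in F\in\mathcal P}x_F$; let $S_M^\circ\subseteq S_M$ be the subalgebra generated by all $t_i-t_j$. The Chow ring is the graded ring $$A^\bullet(M,\mathcal P)=\mathrm{Tor}_0^{S_M^\circ}(\mathbb C[\Sigma_{M,\mathcal P}],\mathbb C)_\bullet=\mathbb C[\Sigma_{M,\mathcal P}]/(\text{images of all } t_i-t_j),$$ and $A^\bullet(M)=A^\bullet(M,\widehat{\mathcal L}(M))$. Let $\Sigma_{M,\mathcal P_-}\rightsquigarrow\Sigma_{M,\mathcal P_+}$ be a matroidal flip with center $Z$, that is, $\mathcal P_-$ and $\mathcal P_+$ are order filters, $Z\notin\mathcal P_-$ and $\mathcal P_+=\mathcal P_-\cup\{Z\}$. Let $M^Z$ be the restriction of $M$ to $Z$ and $M_Z$ the contraction of $M$ by $Z$. Then there is a short exact sequence of graded $\mathbb C$-vector spaces, with maps of degree $0$, $$0\to A^\bullet(M,\mathcal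 P_-)\xrightarrow{\ \iota\ }A^\bullet(M,\mathcal P_+)\xrightarrow{\ g\ }A^{>0}(M^Z,\emptyset)\otimes_{\mathbb C}A^\bullet(M_Z)\to0 .$$ Here the third term is graded by total degree, and the maps are as follows. - $\iota$ is a well-defined homomorphism of $\mathbb C$-algebras with $\iota(x_i)=x_i+x_Z$ for $i\in Z$, $\iota(x_i)=x_i$ for $i\in E\setminus Z$, and $\iota(x_F)=x_F$ for $F\in\mathcal P_-$. - There is a homomorphism of $\mathbb C$-algebras $\theta\colon A^\bullet(M,\mathcal P_+)\to A^\bullet(M^Z,\emptyset)\otimes_{\mathbb C}A^\bullet(M_Z)$ with $\theta(x_i)=x_i\otimes1$ for $i\in Z$, $\theta(x_i)=0$ for $i\in E\setminus Z$, $\theta(x_F)=1\otimes x_{F\setminus Z}$ for $F\in\mathcal P_+$ with $F\supsetneq Z$, and $\theta(x_F)=0$ for $F\in\mathcal P_+$ with $F\not\supseteq Z$. The map $g$ is linear and is $\theta$ modulo $1\otimes A^\bullet(M_Z)$: for each $y$ one has $\theta(y)\in g(y)+1\otimes A^\bullet(M_Z)$. -/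

import Mathlib

open scoped TensorProduct

noncomputable section

namespace FlipChow

variable {α : Type*}

/-! ### Flats, spanning, order filters and flips -/

/-- The poset of proper non-empty flats of `M`, as a set of subsets of the ground set. -/
def properFlats (M : Matroid α) : Set (Set α) :=
  {F | M.IsFlat F ∧ F.Nonempty ∧ F ≠ M.E}

/-- An order filter of `M`: a set of proper non-empty flats closed under upward inclusion. -/
structure IsOrderFilter (M : Matroid α) (P : Set (Set α)) : Prop where
  subset_properFlats : P ⊆ properFlats M
  mem_of_subset : ∀ F ∈ P, ∀ G ∈ properFlats M, F ⊆ G → G ∈ P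

/-- `I` spans `F`: `I` is contained in `F` and has the same rank. -/
def Spans (M : Matroid α) (I F : Set α) : Prop :=
  I ⊆ F ∧ M.eRk I = M.eRk F

/-- A matroidal flip from `Pm` to `Pp` with center `Z`: two order filters that differ by
the one flat `Z`, which lies in `Pp` and not in `Pm`. -/
structure IsMatroidalFlip (M : Matroid α) (Pm Pp : Set (Set α)) (Z : Set α) : Prop where
  filter_minus : IsOrderFilter M Pm
  filter_plus : IsOrderFilter M Pp
  center_notMem : Z ∉ Pm
  eq_insert : Pp = insert Z Pm

/-! ### Bergman fans -/

/-- The quotient space `ℝ^E / ℝ·(1,…,1)`, where `E` is the ground set of `M`. -/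
abbrev Ambient (M : Matroid α) : Type _ :=
  (M.E → ℝ) ⧸ (Submodule.span ℝ {(1 : M.E → ℝ)})

open Classical in
/-- The vector `e_S`, the class of the indicator vector of `S`, that is, the sum of the classes
of the standard basis vectors indexed by the elements of `S`. -/
def eVec (M : Matroid α) (S : Set α) : Ambient M :=
  Submodule.Quotient.mk (fun i : M.E => if (i : α) ∈ S then (1 : ℝ) else 0)

/-- The cone `σ_{I < 𝓕}` generated by the `e_i` with `i ∈ I` and the `e_F` with `F ∈ 𝓕`. -/
def sigmaCone (M : Matroid α) (I : Set α) (C : Set (Set α)) : PointedCone ℝ (Ambient M) :=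
  PointedCone.hull ℝ ((fun i => eVec M {i}) '' I ∪ eVec M '' C)

/-- The Bergman fan `Σ_{M,P}`: all cones `σ_{I < 𝓕}` where `I` is a subset of the ground set that
spans no element of `P ∪ {E}`, and `𝓕` is a chain in `P` each element of which contains `I`. -/
def bergmanFan (M : Matroid α) (P : Set (Set α)) : Set (PointedCone ℝ (Ambient M)) :=
  {σ | ∃ (I : Set α) (C : Set (Set α)), I ⊆ M.E ∧ C ⊆ P ∧ IsChain (· ⊆ ·) C ∧
    (∀ F ∈ C, I ⊆ F) ∧ (∀ G ∈ insert M.E P, ¬ Spans M I G) ∧ σ = sigmaCone M I C}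

/-! ### Stanley-Reisner rings of fans -/

section StanleyReisner

variable {V : Type*} [AddCommGroup V] [Module ℝ V]

/-- The rays of a fan: its one-dimensional cones. -/
def rays (Φ : Set (PointedCone ℝ V)) : Set (PointedCone ℝ V) :=
  {ρ | ρ ∈ Φ ∧ Module.finrank ℝ (Submodule.span ℝ (ρ : Set V)) = 1}

/-- The Stanley-Reisner ideal: generated by the products `x_{ρ₁} ⋯ x_{ρₛ}` such that the cone
generated by the rays `ρ₁, …, ρₛ` does not belong to the fan. -/
def srIdeal (Φ : Set (PointedCone ℝ V)) : Ideal (MvPolynomial (rays Φ) ℂ) :=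
  Ideal.span {m | ∃ s : Finset (rays Φ),
    (s.sup fun ρ => (ρ : PointedCone ℝ V)) ∉ Φ ∧ m = ∏ ρ ∈ s, MvPolynomial.X ρ}

/-- The Stanley-Reisner ring `ℂ[Φ]`. -/
def SRRing (Φ : Set (PointedCone ℝ V)) : Type _ :=
  MvPolynomial (rays Φ) ℂ ⧸ srIdeal Φ

instance (Φ : Set (PointedCone ℝ V)) : CommRing (SRRing Φ) :=
  inferInstanceAs (CommRing (MvPolynomial (rays Φ) ℂ ⧸ srIdeal Φ))

instance (Φ : Set (PointedCone ℝ V)) : Algebra ℂ (SRRing Φ) :=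
  inferInstanceAs (Algebra ℂ (MvPolynomial (rays Φ) ℂ ⧸ srIdeal Φ))

/-- The quotient map onto the Stanley-Reisner ring. -/
def srMk (Φ : Set (PointedCone ℝ V)) : MvPolynomial (rays Φ) ℂ →ₐ[ℂ] SRRing Φ :=
  Ideal.Quotient.mkₐ ℂ (srIdeal Φ)

open Classical in
/-- The generator of the Stanley-Reisner ring attached to the cone `ρ`
(zero if `ρ` is not a ray of the fan). -/
def srGen (Φ : Set (PointedCone ℝ V)) (ρ : PointedCone ℝ V) : SRRing Φ :=
  if h : ρ ∈ rays Φ then srMk Φ (MvPolynomial.X ⟨ρ, h⟩) else 0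

end StanleyReisner

open Classical in
/-- The element `δ_i x_i` of `ℂ[Σ_{M,P}]`: the variable of the ray `σ_{{i} < ∅}` if `{i}` spans no
element of `P ∪ {E}`, and zero otherwise. (If `{i}` is itself a flat in `P`, then the ray
generated by `e_i` belongs to the variable `x_F` with `F = {i}`, and `δ_i x_i` is zero.) -/
def srElt (M : Matroid α) (P : Set (Set α)) (i : α) : SRRing (bergmanFan M P) :=
  if ∀ G ∈ insert M.E P, ¬ Spans M {i} G then
    srGen (bergmanFan M P) (sigmaCone M {i} ∅) else 0

/-- The variable `x_F` of `ℂ[Σ_{M,P}]`, for `F` in `P`. -/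
def srFlat (M : Matroid α) (P : Set (Set α)) (F : Set α) : SRRing (bergmanFan M P) :=
  srGen (bergmanFan M P) (sigmaCone M ∅ {F})

/-! ### Chow rings -/

/-- The structure map `S_M = ℂ[x_i : i ∈ E] → ℂ[Σ_{M,P}]`, sending `x_i` to
`δ_i x_i + ∑_{F ∈ P, i ∈ F} x_F`. -/
def structureMap (M : Matroid α) (P : Set (Set α)) :
    MvPolynomial M.E ℂ →ₐ[ℂ] SRRing (bergmanFan M P) :=
  MvPolynomial.aeval fun i : M.E =>
    srElt M P i + ∑ᶠ F ∈ {F | F ∈ P ∧ (i : α) ∈ F}, srFlat M P F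

/-- The ideal of `ℂ[Σ_{M,P}]` generated by the images of the differences `x_i - x_j`, that is,
by the elements of degree one of the subring `S_M° ⊆ S_M` generated by these differences. It is the
image of the last differential of the Koszul complex of `ℂ[Σ_{M,P}]` over `S_M°`. -/
def linearIdeal (M : Matroid α) (P : Set (Set α)) : Ideal (SRRing (bergmanFan M P)) :=
  Ideal.span {f | ∃ i j : M.E,
    f = structureMap M P (MvPolynomial.X i - MvPolynomial.X j)}

/-- The Chow ring `A(M,P) = Tor_0(ℂ[Σ_{M,P}], ℂ) = ℂ[Σ_{M,P}] ⊗ ℂ` (over `S_M°`), that is, the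
Stanley-Reisner ring modulo the linear forms `x_i - x_j` of `S_M°`. -/
def Chow (M : Matroid α) (P : Set (Set α)) : Type _ :=
  SRRing (bergmanFan M P) ⧸ linearIdeal M P

instance (M : Matroid α) (P : Set (Set α)) : CommRing (Chow M P) :=
  inferInstanceAs (CommRing (SRRing (bergmanFan M P) ⧸ linearIdeal M P))

instance (M : Matroid α) (P : Set (Set α)) : Algebra ℂ (Chow M P) :=
  inferInstanceAs (Algebra ℂ (SRRing (bergmanFan M P) ⧸ linearIdeal M P))

/-- The quotient map from the Stanley-Reisner ring onto the Chow ring. -/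
def chowMk (M : Matroid α) (P : Set (Set α)) : SRRing (bergmanFan M P) →ₐ[ℂ] Chow M P :=
  Ideal.Quotient.mkₐ ℂ (linearIdeal M P)

/-- The class of `δ_i x_i` in the Chow ring. -/
def xElt (M : Matroid α) (P : Set (Set α)) (i : α) : Chow M P :=
  chowMk M P (srElt M P i)

/-- The class of `x_F` in the Chow ring. -/
def xFlat (M : Matroid α) (P : Set (Set α)) (F : Set α) : Chow M P :=
  chowMk M P (srFlat M P F)

/-- The piece `A^s(M,P)` of degree `s`: the classes of homogeneous polynomials of degree `s`. -/
def gradedPiece (M : Matroid α) (P : Set (Set α)) (s : ℕ) : Submodule ℂ (Chow M P) :=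
  (MvPolynomial.homogeneousSubmodule (rays (bergmanFan M P)) ℂ s).map
    ((chowMk M P).comp (srMk (bergmanFan M P))).toLinearMap

/-- The part `A^{>0}(M,P)` of positive degree. -/
def positivePart (M : Matroid α) (P : Set (Set α)) : Submodule ℂ (Chow M P) :=
  ⨆ s : {s : ℕ // 0 < s}, gradedPiece M P s

/-- The Chow ring `A(M)` is taken with respect to the order filter of all proper non-empty
flats. -/
abbrev FullChow (M : Matroid α) : Type _ := Chow M (properFlats M)

/-! ### The third term of the flip sequence -/

/-- `A(M^Z, ∅) ⊗ A(M_Z)`, with `M^Z` the restriction to `Z` and `M_Z` the contraction of `Z`. -/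
abbrev FlipTensor (M : Matroid α) (Z : Set α) : Type _ :=
  Chow (M.restrict Z) ∅ ⊗[ℂ] FullChow (M.contract Z)

/-- `A^{>0}(M^Z, ∅) ⊗ A(M_Z)`. -/
abbrev FlipTerm (M : Matroid α) (Z : Set α) : Type _ :=
  positivePart (M.restrict Z) ∅ ⊗[ℂ] FullChow (M.contract Z)

/-- The inclusion of `A^{>0}(M^Z, ∅) ⊗ A(M_Z)` in `A(M^Z, ∅) ⊗ A(M_Z)`. -/
def flipInclusion (M : Matroid α) (Z : Set α) : FlipTerm M Z →ₗ[ℂ] FlipTensor M Z :=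
  (positivePart (M.restrict Z) ∅).subtype.rTensor (FullChow (M.contract Z))

/-- The piece of degree `s` of `A^{>0}(M^Z, ∅) ⊗ A(M_Z)`: the sum of the
`A^{s₁}(M^Z, ∅) ⊗ A^{s₂}(M_Z)` with `s₁ > 0` and `s₁ + s₂ = s`. -/
def flipTermPiece (M : Matroid α) (Z : Set α) (s : ℕ) : Submodule ℂ (FlipTerm M Z) :=
  Submodule.span ℂ {t | ∃ (s₁ s₂ : ℕ) (a : positivePart (M.restrict Z) ∅)
    (b : FullChow (M.contract Z)), 0 < s₁ ∧ s₁ + s₂ = s ∧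
    (a : Chow (M.restrict Z) ∅) ∈ gradedPiece (M.restrict Z) ∅ s₁ ∧
    b ∈ gradedPiece (M.contract Z) (properFlats (M.contract Z)) s₂ ∧ t = a ⊗ₜ[ℂ] b}

end FlipChow

end

noncomputable section

namespace FlipChow

variable {α : Type*}

/-! ### Matroid preliminaries -/

section MatroidLemmas

variable {M : Matroid α} {P : Set (Set α)} {I F G : Set α}

/-! Write A₋ and A₊ for the Chow rings of the two filters, x^I for a product of the x_i, and r > 0
for the rank of Z. The convex geometry serves only to present the Chow ring by the x_i and x_F
subject to `ChowRel`: `chowRel_chow` gives the relations, `ChowRel.lift` the universal property.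
Every homomorphism below is then built by checking relations on generators.

Besides ι and θ there is a third map, `link` : A₋ → A(M_Z). It kills x_j for j outside Z and x_F for
F not above Z, sends x_F to x_{F \ Z} otherwise, and sends every x_i with i in Z to one element γ of
degree one. It satisfies θ ∘ ι = 1 ⊗ link. Two annihilation statements carry the argument: ker link
kills x^I when I spans Z (`FlipMaps.mul_prod_eq_zero`), and ker θ kills x_Z
(`FlipMaps.mul_center_eq_zero`). In both, the quotient by the annihilator satisfies the relations of
the target of the map, so the quotient map factors through it.

Injectivity of ι (`FlipMaps.ι_injective`): A₊ maps to A₋[X]/K with x_Z ↦ X, where K is generated by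
∏ (x_i - X) over a basis I of Z and by the polynomials without constant term over ker link. The
composite with ι is the map of constants. If a constant a lies in K, comparing degrees over A(M_Z)
and then setting X = 0 gives a = c x^I with c in ker link, so a = 0.

Exactness in the middle (`FlipMaps.exists_ι_eq`): an element of A₊ is q(x_Z) with q over A₋ of
degree < r. If θ sends it to 1 ⊗ b, then reading θ in A(M_Z)[X]/(X^r) shows that all coefficients of
q except the constant one lie in ker link. The terms divisible by x_Z then vanish together, and the
element is ι of the constant coefficient.

The map g is θ followed by the projection of A(M^Z, ∅) onto its positive part along an augmentation.
It is surjective because θ is. -/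

lemma spans_iff_closure_eq [M.Finite] (hG : M.IsFlat G) :
    Spans M I G ↔ I ⊆ M.E ∧ M.closure I = G := by
  constructor
  · rintro ⟨hIG, hr⟩
    refine ⟨hIG.trans hG.subset_ground, ?_⟩
    have hfin : M.IsRkFinite I := by
      rw [← Matroid.eRk_ne_top_iff, ← lt_top_iff_ne_top]
      refine (M.eRk_le_encard I).trans_lt ?_
      exact (M.ground_finite.subset (hIG.trans hG.subset_ground)).encard_lt_top
    rw [hfin.closure_eq_closure_of_subset_of_eRk_ge_eRk hIG hr.ge, hG.closure]
  · rintro ⟨hI, rfl⟩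
    exact ⟨M.subset_closure I hI, (M.eRk_closure_eq I).symm⟩

lemma IsOrderFilter.isFlat (hP : IsOrderFilter M P) (hG : G ∈ insert M.E P) : M.IsFlat G := by
  rcases hG with rfl | hG
  · exact M.ground_isFlat
  · exact (hP.subset_properFlats hG).1

lemma IsOrderFilter.spans_iff [M.Finite] (hP : IsOrderFilter M P) :
    (∃ G ∈ insert M.E P, Spans M I G) ↔ I ⊆ M.E ∧ M.closure I ∈ insert M.E P := by
  constructor
  · rintro ⟨G, hG, hs⟩
    obtain ⟨h1, rfl⟩ := (spans_iff_closure_eq (hP.isFlat hG)).1 hs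
    exact ⟨h1, hG⟩
  · rintro ⟨h1, h2⟩
    exact ⟨_, h2, (spans_iff_closure_eq (hP.isFlat h2)).2 ⟨h1, rfl⟩⟩

lemma IsOrderFilter.forall_not_spans_iff [M.Finite] (hP : IsOrderFilter M P) (hI : I ⊆ M.E) :
    (∀ G ∈ insert M.E P, ¬ Spans M I G) ↔ M.closure I ∉ insert M.E P := by
  have := hP.spans_iff (I := I)
  constructor
  · intro h hc
    obtain ⟨G, hG, hs⟩ := this.2 ⟨hI, hc⟩
    exact h G hG hs
  · intro h G hG hs
    exact h (this.1 ⟨G, hG, hs⟩).2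

lemma IsOrderFilter.mem_insert_of_subset (hP : IsOrderFilter M P) (hF : F ∈ insert M.E P)
    (hG : M.IsFlat G) (hFG : F ⊆ G) : G ∈ insert M.E P := by
  by_cases hE : G = M.E
  · exact Or.inl hE
  rcases hF with rfl | hF
  · exact absurd (hG.subset_ground.antisymm hFG) hE
  · exact Or.inr (hP.mem_of_subset F hF G
      ⟨hG, (hP.subset_properFlats hF).2.1.mono hFG, hE⟩ hFG)

lemma IsOrderFilter.finite [M.Finite] (hP : IsOrderFilter M P) : P.Finite :=
  M.ground_finite.finite_subsets.subset fun _ hF => (hP.subset_properFlats hF).1.subset_ground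

lemma isOrderFilter_empty (M : Matroid α) : IsOrderFilter M ∅ :=
  ⟨Set.empty_subset _, by simp⟩

lemma isOrderFilter_properFlats (M : Matroid α) : IsOrderFilter M (properFlats M) :=
  ⟨subset_rfl, fun _ _ _ hG _ => hG⟩

end MatroidLemmas

/-! ### Linear functionals on the ambient space -/

section Geometry

variable {M : Matroid α} {P : Set (Set α)}

/-- The functional `v ↦ v e - v z` on `ℝ^E`. -/
def coordDiffAux (M : Matroid α) (e z : M.E) : (M.E → ℝ) →ₗ[ℝ] ℝ where
  toFun v := v e - v z
  map_add' v w := by rw [Pi.add_apply, Pi.add_apply]; ring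
  map_smul' c v := by
    rw [Pi.smul_apply, Pi.smul_apply, smul_eq_mul, smul_eq_mul, RingHom.id_apply, smul_eq_mul]
    ring

/-- The functional `v ↦ v e - v z` on `ℝ^E / ℝ(1,…,1)`. -/
def coordDiff (M : Matroid α) (e z : M.E) : Ambient M →ₗ[ℝ] ℝ :=
  Submodule.liftQ _ (coordDiffAux M e z) (by
    rw [Submodule.span_le]
    rintro x rfl
    exact sub_self (1 : ℝ))

open Classical in
lemma coordDiff_eVec (e z : M.E) (S : Set α) :
    coordDiff M e z (eVec M S) =
      (if (e : α) ∈ S then 1 else 0) - (if (z : α) ∈ S then 1 else 0) := by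
  rw [coordDiff, eVec]
  exact Submodule.liftQ_apply _ (coordDiffAux M e z) _

lemma nonneg_of_mem_hull {V : Type*} [AddCommGroup V] [Module ℝ V] (l : V →ₗ[ℝ] ℝ) {s : Set V}
    (hs : ∀ v ∈ s, 0 ≤ l v) {v : V} (hv : v ∈ PointedCone.hull ℝ s) : 0 ≤ l v := by
  induction hv using Submodule.span_induction with
  | mem x h => exact hs x h
  | zero => simp
  | add x y _ _ hx hy => rw [map_add]; exact add_nonneg hx hy
  | smul a x _ hx =>
    have : l (a • x) = (a : ℝ) * l x := by
      rw [← smul_eq_mul, ← map_smul]; rfl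
    rw [this]
    exact mul_nonneg a.2 hx

/-- The functional v_f - v_e is nonnegative on every generator of the cone, while it would be -1 on
e_S if S contained e but not f. -/
lemma mem_of_eVec_mem_sigmaCone {I : Set α} {C : Set (Set α)} {S : Set α}
    (hS : eVec M S ∈ sigmaCone M I C) {e f : M.E}
    (h1 : (e : α) ∉ I) (h2 : ∀ F ∈ C, (e : α) ∈ F → (f : α) ∈ F)
    (he : (e : α) ∈ S) : (f : α) ∈ S := by
  classical
  by_contra hf
  have := nonneg_of_mem_hull (coordDiff M f e) ?_ hS
  · rw [coordDiff_eVec, if_pos he, if_neg hf] at this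
    norm_num at this
  · rintro v (⟨i, hi, rfl⟩ | ⟨F, hF, rfl⟩)
    · have : (e : α) ∉ ({i} : Set α) := by
        rintro rfl
        exact h1 hi
      rw [coordDiff_eVec, if_neg this]
      split_ifs <;> norm_num
    · rw [coordDiff_eVec]
      have := h2 F hF
      split_ifs <;> simp_all

/-- The cone generated by the vector `e_S`. -/
def rayCone (M : Matroid α) (S : Set α) : PointedCone ℝ (Ambient M) :=
  PointedCone.hull ℝ {eVec M S}

lemma eVec_mem_rayCone (S : Set α) : eVec M S ∈ rayCone M S :=
  PointedCone.subset_hull rfl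

lemma sigmaCone_singleton_empty (i : α) : sigmaCone M {i} ∅ = rayCone M {i} := by
  simp [sigmaCone, rayCone]

lemma sigmaCone_empty_singleton (F : Set α) : sigmaCone M ∅ {F} = rayCone M F := by
  simp [sigmaCone, rayCone]

lemma span_rayCone (S : Set α) :
    Submodule.span ℝ (rayCone M S : Set (Ambient M)) = Submodule.span ℝ {eVec M S} := by
  apply le_antisymm
  · rw [Submodule.span_le]
    exact PointedCone.hull_le_span (R := ℝ) _
  · exact Submodule.span_mono (Set.singleton_subset_iff.2 (eVec_mem_rayCone S))

lemma eVec_ne_zero {S : Set α} (hS : S.Nonempty) (hSE : S ⊂ M.E) : eVec M S ≠ 0 := by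
  classical
  intro h0
  obtain ⟨e, he⟩ := hS
  obtain ⟨z, hz, hzS⟩ := Set.not_subset.1 hSE.2
  have := coordDiff_eVec (M := M) ⟨e, hSE.1 he⟩ ⟨z, hz⟩ S
  rw [h0, map_zero, if_pos he, if_neg hzS] at this
  norm_num at this

lemma finrank_span_rayCone {S : Set α} (hS : S.Nonempty) (hSE : S ⊂ M.E) :
    Module.finrank ℝ (Submodule.span ℝ (rayCone M S : Set (Ambient M))) = 1 := by
  rw [span_rayCone]
  exact finrank_span_singleton (eVec_ne_zero hS hSE)

/-- An element z of S outside T has coordinate zero in the only generator e_T, so z in S would force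
every element of the ground set into S. -/
lemma subset_of_rayCone_eq {S T : Set α} (hSE : S ⊂ M.E) (h : rayCone M S = rayCone M T) :
    S ⊆ T := by
  have hS : eVec M S ∈ sigmaCone M ∅ {T} := by
    rw [sigmaCone_empty_singleton, ← h]
    exact eVec_mem_rayCone S
  intro z hz
  by_contra hzT
  refine hSE.2 fun f hf => ?_
  refine mem_of_eVec_mem_sigmaCone (e := ⟨z, hSE.1 hz⟩) (f := ⟨f, hf⟩) hS (by simp) ?_ hz
  rintro F rfl h
  exact absurd h hzT

lemma rayCone_injOn : Set.InjOn (rayCone M) {S | S ⊂ M.E} := fun _ hS _ hT h =>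
  (subset_of_rayCone_eq hS h).antisymm (subset_of_rayCone_eq hT h.symm)

/-- The pairs `I < C` that index the cones of the Bergman fan. -/
structure IsFace (M : Matroid α) (P : Set (Set α)) (I : Set α) (C : Set (Set α)) : Prop where
  subset_ground : I ⊆ M.E
  subset_filter : C ⊆ P
  isChain : IsChain (· ⊆ ·) C
  subset_of_mem : ∀ F ∈ C, I ⊆ F
  closure_notMem : M.closure I ∉ insert M.E P

variable [M.Finite]

lemma mem_bergmanFan_iff (hP : IsOrderFilter M P) {σ : PointedCone ℝ (Ambient M)} :
    σ ∈ bergmanFan M P ↔ ∃ I C, IsFace M P I C ∧ σ = sigmaCone M I C := by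
  constructor
  · rintro ⟨I, C, h1, h2, h3, h4, h5, h6⟩
    exact ⟨I, C, ⟨h1, h2, h3, h4, (hP.forall_not_spans_iff h1).1 h5⟩, h6⟩
  · rintro ⟨I, C, h, h6⟩
    exact ⟨I, C, h.1, h.2, h.3, h.4, (hP.forall_not_spans_iff h.1).2 h.5, h6⟩

lemma exists_greatest_of_isChain {C : Set (Set α)} (hfin : C.Finite) (hne : C.Nonempty)
    (hC : IsChain (· ⊆ ·) C) : ∃ F ∈ C, ∀ G ∈ C, G ⊆ F := by
  obtain ⟨F, hF⟩ := hfin.exists_maximal hne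
  refine ⟨F, hF.prop, fun G hG => ?_⟩
  rcases hC.total hF.prop hG with h | h
  · exact hF.le_of_ge hG h
  · exact h

lemma exists_least_of_isChain {C : Set (Set α)} (hfin : C.Finite) (hne : C.Nonempty)
    (hC : IsChain (· ⊆ ·) C) : ∃ F ∈ C, ∀ G ∈ C, F ⊆ G := by
  obtain ⟨F, hF⟩ := hfin.exists_minimal hne
  refine ⟨F, hF.prop, fun G hG => ?_⟩
  rcases hC.total hF.prop hG with h | h
  · exact h
  · exact hF.le_of_le hG h

/-- Such a z gives a coordinate that vanishes on all generators, which normalises representatives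
modulo (1,…,1). It is found outside the largest flat of the chain or, when the chain is empty,
outside I. -/
lemma IsFace.exists_notMem (hP : IsOrderFilter M P) {I : Set α} {C : Set (Set α)}
    (h : IsFace M P I C) : ∃ z : M.E, (z : α) ∉ I ∧ ∀ F ∈ C, (z : α) ∉ F := by
  rcases C.eq_empty_or_nonempty with rfl | hne
  · have : ¬ M.E ⊆ I := by
      intro hE
      have : I = M.E := h.subset_ground.antisymm hE
      apply h.closure_notMem
      rw [this, M.closure_ground]
      exact Or.inl rfl
    obtain ⟨z, hz, hzI⟩ := Set.not_subset.1 this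
    exact ⟨⟨z, hz⟩, hzI, by simp⟩
  · obtain ⟨F, hF, hmax⟩ :=
      exists_greatest_of_isChain (hP.finite.subset h.subset_filter) hne h.isChain
    have hFp := hP.subset_properFlats (h.subset_filter hF)
    have : ¬ M.E ⊆ F := fun hE => hFp.2.2 (hFp.1.subset_ground.antisymm hE)
    obtain ⟨z, hz, hzF⟩ := Set.not_subset.1 this
    exact ⟨⟨z, hz⟩, fun hI => hzF (h.subset_of_mem F hF hI), fun G hG hzG => hzF (hmax G hG hzG)⟩

/-- For e in S outside I, some flat of the chain contains e, since otherwise z would be in S, and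
the least such flat lies in S. If S is not inside I, the largest flat of the chain contained in S
therefore exhausts S: it also contains I. -/
lemma IsFace.mem_or_subset (hP : IsOrderFilter M P) {I : Set α} {C : Set (Set α)}
    (h : IsFace M P I C) {S : Set α} (hSE : S ⊂ M.E) (hS : eVec M S ∈ sigmaCone M I C) :
    S ∈ C ∨ S ⊆ I := by
  obtain ⟨z, hzI, hzC⟩ := h.exists_notMem hP
  have hzS : (z : α) ∉ S := by
    intro hz
    refine hSE.2 fun f hf => ?_
    exact mem_of_eVec_mem_sigmaCone (f := ⟨f, hf⟩) hS hzI (fun F hF hz => absurd hz (hzC F hF)) hz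
  have key : ∀ e ∈ S, e ∉ I → ∃ F ∈ C, e ∈ F ∧ F ⊆ S := by
    intro e he heI
    have hne : {F ∈ C | e ∈ F}.Nonempty := by
      by_contra hcon
      refine hzS (mem_of_eVec_mem_sigmaCone (e := ⟨e, hSE.1 he⟩) hS heI (fun F hF heF => ?_) he)
      exact absurd ⟨F, hF, heF⟩ hcon
    obtain ⟨F, hF, hmin⟩ := exists_least_of_isChain
      ((hP.finite.subset h.subset_filter).subset (Set.sep_subset _ _)) hne
      (h.isChain.mono (Set.sep_subset _ _))
    refine ⟨F, hF.1, hF.2, fun f hf => ?_⟩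
    exact mem_of_eVec_mem_sigmaCone (e := ⟨e, hSE.1 he⟩)
      (f := ⟨f, (hP.subset_properFlats (h.subset_filter hF.1)).1.subset_ground hf⟩) hS heI
      (fun G hG heG => hmin G ⟨hG, heG⟩ hf) he
  by_cases hSI : S ⊆ I
  · exact Or.inr hSI
  left
  obtain ⟨e, heS, heI⟩ := Set.not_subset.1 hSI
  obtain ⟨F₀, hF₀, -, hF₀S⟩ := key e heS heI
  obtain ⟨F, hF, hmax⟩ := exists_greatest_of_isChain (C := {F ∈ C | F ⊆ S})
      ((hP.finite.subset h.subset_filter).subset (Set.sep_subset _ _)) ⟨F₀, hF₀, hF₀S⟩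
      (h.isChain.mono (Set.sep_subset _ _))
  have : S = F := by
    refine subset_antisymm (fun x hx => ?_) hF.2
    by_cases hxI : x ∈ I
    · exact h.subset_of_mem F hF.1 hxI
    · obtain ⟨G, hG, hxG, hGS⟩ := key x hx hxI
      exact hmax G ⟨hG, hGS⟩ hxG
  exact this ▸ hF.1

/-- F cannot lie inside I, because the closure of I would then be above F and belong to P ∪ {E}. So
the rays in a cone determine its indices, and non-faces can be recognised combinatorially. -/
lemma IsFace.mem_of_flat (hP : IsOrderFilter M P) {I : Set α} {C : Set (Set α)}
    (h : IsFace M P I C) {F : Set α} (hF : F ∈ P) (hS : eVec M F ∈ sigmaCone M I C) : F ∈ C := by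
  have hFp := hP.subset_properFlats hF
  rcases h.mem_or_subset hP (hFp.1.subset_ground.ssubset_of_ne hFp.2.2) hS with h1 | h1
  · exact h1
  · exact absurd (hP.mem_insert_of_subset (Or.inr hF) (M.isFlat_closure I)
      (h1.trans (M.subset_closure I h.subset_ground))) h.closure_notMem

lemma IsFace.mem_of_elt (hP : IsOrderFilter M P) {I : Set α} {C : Set (Set α)}
    (h : IsFace M P I C) {i : α} (hi : i ∈ M.E) (hiP : M.closure {i} ∉ insert M.E P)
    (hS : eVec M {i} ∈ sigmaCone M I C) : i ∈ I := by
  have hE : {i} ⊂ M.E := by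
    refine (Set.singleton_subset_iff.2 hi).ssubset_of_ne fun hE => hiP ?_
    rw [hE, M.closure_ground]
    exact Or.inl rfl
  rcases h.mem_or_subset hP hE hS with h1 | h1
  · have hmem := h.subset_filter h1
    refine absurd (Or.inr ?_) hiP
    rwa [(hP.subset_properFlats hmem).1.closure]
  · exact h1 rfl

/-- Looplessness enters here: it makes ∅ closed, so ∅ spans no element of P ∪ {E} and the pair ∅ <
{F} is a face. -/
lemma rayCone_flat_mem_rays [M.Loopless] (hP : IsOrderFilter M P) {F : Set α} (hF : F ∈ P) :
    rayCone M F ∈ rays (bergmanFan M P) := by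
  have hFp := hP.subset_properFlats hF
  refine ⟨(mem_bergmanFan_iff hP).2 ⟨∅, {F}, ⟨by simp, by simpa using hF, by simp, by simp, ?_⟩,
    (sigmaCone_empty_singleton F).symm⟩, finrank_span_rayCone hFp.2.1
      (hFp.1.subset_ground.ssubset_of_ne hFp.2.2)⟩
  have : M.closure ∅ = ∅ := M.loops_eq_empty
  rw [this]
  rintro (h | h)
  · exact (hFp.2.1.mono hFp.1.subset_ground).ne_empty h.symm
  · exact (hP.subset_properFlats h).2.1.ne_empty rfl

lemma rayCone_elt_mem_rays (hP : IsOrderFilter M P) {i : α} (hi : i ∈ M.E)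
    (hiP : M.closure {i} ∉ insert M.E P) : rayCone M {i} ∈ rays (bergmanFan M P) := by
  refine ⟨(mem_bergmanFan_iff hP).2 ⟨{i}, ∅, ⟨by simpa using hi, by simp, by simp, by simp, hiP⟩,
    (sigmaCone_singleton_empty i).symm⟩, finrank_span_rayCone (Set.singleton_nonempty i) ?_⟩
  refine (Set.singleton_subset_iff.2 hi).ssubset_of_ne fun hE => hiP ?_
  rw [hE, M.closure_ground]
  exact Or.inl rfl

/-- In a one-dimensional cone all generators are proportional. After normalising the coordinate z to
zero they are indicator vectors of nonempty sets, so proportional ones are equal and the cone has a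
single generator. -/
lemma exists_of_mem_rays (hP : IsOrderFilter M P) {ρ : PointedCone ℝ (Ambient M)}
    (hρ : ρ ∈ rays (bergmanFan M P)) :
    (∃ F ∈ P, ρ = rayCone M F) ∨
      ∃ i ∈ M.E, M.closure {i} ∉ insert M.E P ∧ ρ = rayCone M {i} := by
  classical
  obtain ⟨h1, h2⟩ := hρ
  obtain ⟨I, C, h, rfl⟩ := (mem_bergmanFan_iff hP).1 h1
  obtain ⟨z, hzI, hzC⟩ := h.exists_notMem hP
  set T : Set (Set α) := (fun i => {i}) '' I ∪ C with hT
  have hσ : sigmaCone M I C = PointedCone.hull ℝ (eVec M '' T) := by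
    rw [hT, Set.image_union, Set.image_image]
    rfl
  have hTS : ∀ S ∈ T, S.Nonempty ∧ S ⊆ M.E ∧ (z : α) ∉ S := by
    rintro S (⟨i, hi, rfl⟩ | hS)
    · refine ⟨Set.singleton_nonempty i, Set.singleton_subset_iff.2 (h.subset_ground hi), ?_⟩
      rintro hz
      exact hzI (by rwa [Set.mem_singleton_iff.1 hz])
    · have := hP.subset_properFlats (h.subset_filter hS)
      exact ⟨this.2.1, this.1.subset_ground, hzC S hS⟩
  have hTne : T.Nonempty := by
    by_contra hne
    rw [Set.not_nonempty_iff_eq_empty] at hne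
    rw [hσ, hne, Set.image_empty, PointedCone.hull, Submodule.span_empty] at h2
    rw [show ((⊥ : Submodule _ (Ambient M)) : Set (Ambient M)) = {0} from rfl,
      Submodule.span_zero_singleton, finrank_bot] at h2
    exact zero_ne_one h2
  obtain ⟨S, hS⟩ := hTne
  have hmem : ∀ S ∈ T, eVec M S ∈ Submodule.span ℝ (sigmaCone M I C : Set (Ambient M)) := by
    intro S hS
    apply Submodule.subset_span
    rw [hσ]
    exact PointedCone.subset_hull (Set.mem_image_of_mem _ hS)
  have hSE : S ⊂ M.E := (hTS S hS).2.1.ssubset_of_ne fun hE => (hTS S hS).2.2 (hE ▸ z.2)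
  have hall : ∀ S' ∈ T, S' = S := by
    intro S' hS'
    have := (finrank_eq_one_iff_of_nonzero' (⟨eVec M S, hmem S hS⟩ :
      Submodule.span ℝ (sigmaCone M I C : Set (Ambient M))) (by
        intro h0
        exact eVec_ne_zero (hTS S hS).1 hSE (congrArg Subtype.val h0))).1 h2
        ⟨eVec M S', hmem S' hS'⟩
    obtain ⟨c, hc⟩ := this
    have hc' : c • eVec M S = eVec M S' := congrArg Subtype.val hc
    have hx : ∀ x : M.E, c * (if (x : α) ∈ S then 1 else 0) = if (x : α) ∈ S' then 1 else 0 := by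
      intro x
      have := congrArg (coordDiff M x z) hc'
      rw [map_smul, coordDiff_eVec, coordDiff_eVec, if_neg (hTS S hS).2.2,
        if_neg (hTS S' hS').2.2, sub_zero, sub_zero] at this
      exact this
    obtain ⟨y, hy⟩ := (hTS S' hS').1
    have hc0 : c ≠ 0 := by
      rintro rfl
      have := hx ⟨y, (hTS S' hS').2.1 hy⟩
      rw [if_pos hy] at this
      norm_num at this
    ext x
    constructor
    · intro hxS
      have := hx ⟨x, (hTS S' hS').2.1 hxS⟩
      by_contra hn
      rw [if_pos hxS, if_neg hn] at this
      norm_num at this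
    · intro hxS
      have := hx ⟨x, (hTS S hS).2.1 hxS⟩
      by_contra hn
      rw [if_pos hxS, if_neg hn, mul_one] at this
      exact hc0 this
  have hTeq : T = {S} := Set.eq_singleton_iff_unique_mem.2 ⟨hS, hall⟩
  have hσ' : sigmaCone M I C = rayCone M S := by
    rw [hσ, hTeq, Set.image_singleton]
    rfl
  rcases hS with ⟨i, hi, rfl⟩ | hS
  · refine Or.inr ⟨i, h.subset_ground hi, fun hc => ?_, hσ'⟩
    exact h.closure_notMem (hP.mem_insert_of_subset hc (M.isFlat_closure I)
      (M.closure_subset_closure (Set.singleton_subset_iff.2 hi)))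
  · exact Or.inl ⟨S, h.subset_filter hS, hσ'⟩

end Geometry

/-! ### Universal properties -/

section Lift

variable {V : Type*} [AddCommGroup V] [Module ℝ V] {Φ : Set (PointedCone ℝ V)}
  {B : Type*} [CommRing B] [Algebra ℂ B]

/-- Algebra homomorphisms out of a Stanley-Reisner ring. -/
def SRRing.lift (f : MvPolynomial (rays Φ) ℂ →ₐ[ℂ] B) (hf : ∀ a ∈ srIdeal Φ, f a = 0) :
    SRRing Φ →ₐ[ℂ] B :=
  Ideal.Quotient.liftₐ (srIdeal Φ) f hf

lemma SRRing.lift_srMk (f : MvPolynomial (rays Φ) ℂ →ₐ[ℂ] B) (hf : ∀ a ∈ srIdeal Φ, f a = 0)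
    (a : MvPolynomial (rays Φ) ℂ) : SRRing.lift f hf (srMk Φ a) = f a :=
  Ideal.Quotient.liftₐ_apply (srIdeal Φ) f hf _

lemma srMk_surjective : Function.Surjective (srMk Φ) :=
  Ideal.Quotient.mkₐ_surjective ℂ (srIdeal Φ)

lemma srMk_eq_zero {a : MvPolynomial (rays Φ) ℂ} (ha : a ∈ srIdeal Φ) : srMk Φ a = 0 :=
  Ideal.Quotient.eq_zero_iff_mem.2 ha

lemma srGen_of_mem {ρ : PointedCone ℝ V} (h : ρ ∈ rays Φ) :
    srGen Φ ρ = srMk Φ (MvPolynomial.X ⟨ρ, h⟩) :=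
  dif_pos h

lemma prod_srGen_eq_zero (s : Finset (PointedCone ℝ V)) (hs : ∀ ρ ∈ s, ρ ∈ rays Φ)
    (h : s.sup id ∉ Φ) : ∏ ρ ∈ s, srGen Φ ρ = 0 := by
  classical
  have hsup : (s.attach.image fun ρ => (⟨ρ.1, hs ρ.1 ρ.2⟩ : rays Φ)).sup
      (fun ρ => (ρ : PointedCone ℝ V)) = s.sup id := by
    rw [Finset.sup_image, ← Finset.sup_attach s id]
    rfl
  have hprod : ∏ ρ ∈ s, srGen Φ ρ = srMk Φ (∏ ρ ∈ s.attach.image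
      fun ρ => (⟨ρ.1, hs ρ.1 ρ.2⟩ : rays Φ), MvPolynomial.X ρ) := by
    rw [map_prod, Finset.prod_image (fun (a : s) _ (b : s) _ hab => Subtype.ext (congrArg
      (fun x : rays Φ => (x : PointedCone ℝ V)) hab)), ← Finset.prod_attach s]
    exact Finset.prod_congr rfl fun ρ _ => srGen_of_mem (hs ρ.1 ρ.2)
  rw [hprod]
  exact srMk_eq_zero (Ideal.subset_span ⟨_, hsup ▸ h, rfl⟩)

lemma mem_sup_of_mem {s : Finset (PointedCone ℝ V)} {ρ : PointedCone ℝ V} (h : ρ ∈ s) {x : V}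
    (hx : x ∈ ρ) : x ∈ s.sup id :=
  (Finset.le_sup (f := id) h : id ρ ≤ _) hx

end Lift

/-! ### The combinatorial relations of the Chow ring. -/

section Relations

variable {M : Matroid α} {P : Set (Set α)} {B : Type*} [CommRing B]

/-- The sum of the `v F` over the flats `F` of `P` that contain `i`. -/
def flatSum (P : Set (Set α)) (v : Set α → B) (i : α) : B :=
  ∑ᶠ F ∈ {F | F ∈ P ∧ i ∈ F}, v F

/-- Any additive map commutes with the sums over flats. -/
lemma map_flatSum {B' F : Type*} [CommRing B'] [FunLike F B B'] [AddMonoidHomClass F B B']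
    (f : F) (hP : P.Finite) (v : Set α → B) (i : α) :
    f (flatSum P v i) = flatSum P (fun F => f (v F)) i :=
  AddMonoidHom.map_finsum_mem v (f : B →+ B') (hP.subset fun _ hF => hF.1)

lemma flatSum_congr {v w : Set α → B} (h : ∀ F ∈ P, v F = w F) (i : α) :
    flatSum P v i = flatSum P w i :=
  finsum_mem_congr rfl fun F hF => h F hF.1

/-- The relations of the Chow ring `A(M,P)`, for elements `u i` in place of the `x_i` and `v F` in
place of the `x_F`. -/
structure ChowRel (M : Matroid α) (P : Set (Set α)) (u : α → B) (v : Set α → B) : Prop where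
  flat_mul_flat : ∀ F ∈ P, ∀ G ∈ P, ¬ F ⊆ G → ¬ G ⊆ F → v F * v G = 0
  elt_mul_flat : ∀ i ∈ M.E, ∀ F ∈ P, i ∉ F → u i * v F = 0
  prod_elt : ∀ I : Finset α, (I : Set α) ⊆ M.E → M.closure I ∈ insert M.E P → ∏ i ∈ I, u i = 0
  linear : ∀ i ∈ M.E, ∀ j ∈ M.E, u i + flatSum P v i = u j + flatSum P v j

lemma singleton_ssubset_ground {i : α} (hi : i ∈ M.E) (hiP : M.closure {i} ∉ insert M.E P) :
    {i} ⊂ M.E := by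
  refine (Set.singleton_subset_iff.2 hi).ssubset_of_ne fun hE => hiP ?_
  rw [hE, M.closure_ground]
  exact Or.inl rfl

open Classical in
/-- The value on the variable of a ray that corresponds to `u` and `v`. -/
def rayValue (M : Matroid α) (P : Set (Set α)) (u : α → B) (v : Set α → B)
    (ρ : PointedCone ℝ (Ambient M)) : B :=
  if h : ∃ F ∈ P, rayCone M F = ρ then v h.choose else
    if h : ∃ i ∈ M.E, M.closure {i} ∉ insert M.E P ∧ rayCone M {i} = ρ then u h.choose else 0

lemma rayValue_flat (hP : IsOrderFilter M P) (u : α → B) (v : Set α → B) {F : Set α}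
    (hF : F ∈ P) : rayValue M P u v (rayCone M F) = v F := by
  have h : ∃ G ∈ P, rayCone M G = rayCone M F := ⟨F, hF, rfl⟩
  have hsub : ∀ F ∈ P, F ⊂ M.E := fun F hF =>
    (hP.subset_properFlats hF).1.subset_ground.ssubset_of_ne (hP.subset_properFlats hF).2.2
  rw [rayValue, dif_pos h, rayCone_injOn (hsub _ h.choose_spec.1) (hsub F hF) h.choose_spec.2]

lemma rayValue_elt (hP : IsOrderFilter M P) (u : α → B) (v : Set α → B) {i : α}
    (hi : i ∈ M.E) (hiP : M.closure {i} ∉ insert M.E P) :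
    rayValue M P u v (rayCone M {i}) = u i := by
  have h : ∃ j ∈ M.E, M.closure {j} ∉ insert M.E P ∧ rayCone M {j} = rayCone M {i} :=
    ⟨i, hi, hiP, rfl⟩
  have hn : ¬ ∃ G ∈ P, rayCone M G = rayCone M {i} := by
    rintro ⟨G, hG, hGi⟩
    have hGE : G ⊂ M.E :=
      (hP.subset_properFlats hG).1.subset_ground.ssubset_of_ne (hP.subset_properFlats hG).2.2
    have := rayCone_injOn hGE (singleton_ssubset_ground hi hiP) hGi
    subst this
    rw [(hP.subset_properFlats hG).1.closure] at hiP
    exact hiP (Or.inr hG)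
  have := rayCone_injOn (singleton_ssubset_ground h.choose_spec.1 h.choose_spec.2.1)
    (singleton_ssubset_ground hi hiP) h.choose_spec.2.2
  rw [rayValue, dif_neg hn, dif_pos h, Set.singleton_injective this]

variable [M.Finite]

/-- The rays in s generate σ_{I < C} for the evident I and C. If this is not in the fan, then C is
not a chain, or I is not inside some member of C, or I spans an element of P ∪ {E}; each failure is
one of the product relations. -/
lemma ChowRel.prod_rayValue_eq_zero (hP : IsOrderFilter M P) {u : α → B} {v : Set α → B}
    (h : ChowRel M P u v) (s : Finset (rays (bergmanFan M P)))
    (hs : (s.sup fun ρ => (ρ : PointedCone ℝ (Ambient M))) ∉ bergmanFan M P) :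
    ∏ ρ ∈ s, rayValue M P u v ρ = 0 := by
  classical
  set C : Set (Set α) := {F | F ∈ P ∧ ∃ ρ ∈ s, (ρ : PointedCone ℝ (Ambient M)) = rayCone M F}
    with hC
  set I : Set α := {i | i ∈ M.E ∧ M.closure {i} ∉ insert M.E P ∧
    ∃ ρ ∈ s, (ρ : PointedCone ℝ (Ambient M)) = rayCone M {i}} with hI
  have hsup : (s.sup fun ρ => (ρ : PointedCone ℝ (Ambient M))) = sigmaCone M I C := by
    apply le_antisymm
    · apply Finset.sup_le
      intro ρ hρ
      rcases exists_of_mem_rays hP ρ.2 with ⟨F, hF, hρF⟩ | ⟨i, hi, hiP, hρi⟩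
      · rw [hρF]
        refine Submodule.span_mono (Set.singleton_subset_iff.2 (Or.inr ⟨F, ⟨hF, ρ, hρ, hρF⟩, rfl⟩))
      · rw [hρi]
        refine Submodule.span_mono
          (Set.singleton_subset_iff.2 (Or.inl ⟨i, ⟨hi, hiP, ρ, hρ, hρi⟩, rfl⟩))
    · refine Submodule.span_le.2 ?_
      rintro x (⟨i, ⟨hi, hiP, ρ, hρ, hρi⟩, rfl⟩ | ⟨F, ⟨hF, ρ, hρ, hρF⟩, rfl⟩)
      · refine (Finset.le_sup (f := fun ρ : rays (bergmanFan M P) =>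
          (ρ : PointedCone ℝ (Ambient M))) hρ) ?_
        rw [hρi]
        exact eVec_mem_rayCone _
      · refine (Finset.le_sup (f := fun ρ : rays (bergmanFan M P) =>
          (ρ : PointedCone ℝ (Ambient M))) hρ) ?_
        rw [hρF]
        exact eVec_mem_rayCone _
  rw [hsup, mem_bergmanFan_iff hP] at hs
  have hIE : I ⊆ M.E := fun i hi => hi.1
  have two : ∀ ρ ∈ s, ∀ τ ∈ s, ρ ≠ τ → rayValue M P u v ρ * rayValue M P u v τ = 0 →
      ∏ ρ ∈ s, rayValue M P u v ρ = 0 := by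
    intro ρ hρ τ hτ hne h0
    rw [← Finset.mul_prod_erase s _ hρ, ← Finset.mul_prod_erase (s.erase ρ) _
      (Finset.mem_erase.2 ⟨hne.symm, hτ⟩), ← mul_assoc, h0, zero_mul]
  by_contra hprod
  refine hs ⟨I, C, ⟨hIE, fun F hF => hF.1, ?_, ?_, ?_⟩, rfl⟩
  · rintro F ⟨hF, ρ, hρ, hρF⟩ G ⟨hG, τ, hτ, hτG⟩ hne
    by_contra hcon
    rw [not_or] at hcon
    refine hprod (two ρ hρ τ hτ ?_ ?_)
    · rintro rfl
      rw [hρF] at hτG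
      exact hcon.1 (subset_of_rayCone_eq ((hP.subset_properFlats hF).1.subset_ground.ssubset_of_ne
        (hP.subset_properFlats hF).2.2) hτG)
    · rw [hρF, hτG, rayValue_flat hP u v hF, rayValue_flat hP u v hG]
      exact h.flat_mul_flat F hF G hG hcon.1 hcon.2
  · rintro F ⟨hF, ρ, hρ, hρF⟩ i ⟨hi, hiP, τ, hτ, hτi⟩
    by_contra hiF
    refine hprod (two τ hτ ρ hρ ?_ ?_)
    · rintro rfl
      rw [hτi] at hρF
      exact hiF (subset_of_rayCone_eq (singleton_ssubset_ground hi hiP) hρF rfl)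
    · rw [hρF, hτi, rayValue_flat hP u v hF, rayValue_elt hP u v hi hiP]
      exact h.elt_mul_flat i hi F hF hiF
  · intro hcl
    have hfin : I.Finite := M.ground_finite.subset hIE
    refine hprod ?_
    have h0 := h.prod_elt hfin.toFinset (by simpa using hIE) (by simpa using hcl)
    -- For empty s the relation for the empty product already reads 1 = 0, which is the goal.
    -- Otherwise a ray exists, as the choice of `r` requires.
    by_cases hs0 : s.Nonempty
    swap
    · rw [Finset.not_nonempty_iff_eq_empty] at hs0
      have : I = ∅ := by
        rw [Set.eq_empty_iff_forall_notMem]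
        rintro i ⟨-, -, ρ, hρ, -⟩
        simp [hs0] at hρ
      subst hs0
      simp only [this, Set.Finite.toFinset_empty] at h0
      exact h0
    have : Nonempty (rays (bergmanFan M P)) := ⟨hs0.choose⟩
    choose! r hr using fun i (hi : i ∈ I) => hi.2.2
    have hinj : Set.InjOn r (hfin.toFinset : Set α) := by
      intro i hi j hj hij
      rw [Finset.mem_coe, Set.Finite.mem_toFinset] at hi hj
      have h1 := (hr i hi).2
      rw [hij, (hr j hj).2] at h1
      exact Set.singleton_injective (rayCone_injOn (singleton_ssubset_ground hj.1 hj.2.1)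
        (singleton_ssubset_ground hi.1 hi.2.1) h1).symm
    -- The vanishing product over I divides the product over all of s.
    rw [← zero_dvd_iff, ← h0]
    have : ∏ i ∈ hfin.toFinset, u i = ∏ ρ ∈ hfin.toFinset.image r, rayValue M P u v ρ := by
      rw [Finset.prod_image hinj]
      refine Finset.prod_congr rfl fun i hi => ?_
      rw [Set.Finite.mem_toFinset] at hi
      rw [(hr i hi).2, rayValue_elt hP u v hi.1 hi.2.1]
    rw [this]
    refine Finset.prod_dvd_prod_of_subset _ _ _ ?_
    intro ρ hρ
    obtain ⟨i, hi, rfl⟩ := Finset.mem_image.1 hρ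
    rw [Set.Finite.mem_toFinset] at hi
    exact (hr i hi).1

end Relations

/-! ### The presentation of the Chow ring. -/

section ChowLift

variable {M : Matroid α} {P : Set (Set α)} {B : Type*} [CommRing B] [Algebra ℂ B]

/-- Algebra homomorphisms out of a Chow ring. -/
def Chow.liftSR (f : SRRing (bergmanFan M P) →ₐ[ℂ] B) (hf : ∀ a ∈ linearIdeal M P, f a = 0) :
    Chow M P →ₐ[ℂ] B :=
  Ideal.Quotient.liftₐ (linearIdeal M P) f hf

lemma Chow.liftSR_chowMk (f : SRRing (bergmanFan M P) →ₐ[ℂ] B)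
    (hf : ∀ a ∈ linearIdeal M P, f a = 0) (a : SRRing (bergmanFan M P)) :
    Chow.liftSR f hf (chowMk M P a) = f a :=
  Ideal.Quotient.liftₐ_apply (linearIdeal M P) f hf _

lemma chowMk_surjective : Function.Surjective (chowMk M P) :=
  Ideal.Quotient.mkₐ_surjective ℂ (linearIdeal M P)

lemma chowMk_eq_zero {a : SRRing (bergmanFan M P)} (ha : a ∈ linearIdeal M P) :
    chowMk M P a = 0 :=
  Ideal.Quotient.eq_zero_iff_mem.2 ha

lemma srFlat_eq_srGen (F : Set α) :
    srFlat M P F = srGen (bergmanFan M P) (rayCone M F) := by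
  rw [srFlat, sigmaCone_empty_singleton]

variable [M.Finite]

lemma srElt_eq_zero (hP : IsOrderFilter M P) {i : α} (hi : i ∈ M.E)
    (h : M.closure {i} ∈ insert M.E P) : srElt M P i = 0 := by
  rw [srElt, if_neg]
  rw [hP.forall_not_spans_iff (Set.singleton_subset_iff.2 hi)]
  exact not_not.2 h

lemma srElt_eq_srGen (hP : IsOrderFilter M P) {i : α} (hi : i ∈ M.E)
    (h : M.closure {i} ∉ insert M.E P) :
    srElt M P i = srGen (bergmanFan M P) (rayCone M {i}) := by
  rw [srElt, if_pos, sigmaCone_singleton_empty]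
  rwa [hP.forall_not_spans_iff (Set.singleton_subset_iff.2 hi)]

lemma ray_class (hP : IsOrderFilter M P) (ρ : rays (bergmanFan M P)) :
    (∃ F ∈ P, chowMk M P (srMk _ (MvPolynomial.X ρ)) = xFlat M P F) ∨
      ∃ i ∈ M.E, chowMk M P (srMk _ (MvPolynomial.X ρ)) = xElt M P i := by
  rcases exists_of_mem_rays hP ρ.2 with ⟨F, hF, hρF⟩ | ⟨i, hi, hiP, hρi⟩
  · refine Or.inl ⟨F, hF, ?_⟩
    rw [xFlat, srFlat_eq_srGen, ← hρF, srGen_of_mem ρ.2]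
  · refine Or.inr ⟨i, hi, ?_⟩
    rw [xElt, srElt_eq_srGen hP hi hiP, ← hρi, srGen_of_mem ρ.2]

/-- Either some x_i is zero by convention, or the rays are distinct and generate no cone of the fan:
a face J < C containing them has I inside J, which puts the closure of J in P ∪ {E}. -/
lemma prod_srElt (hP : IsOrderFilter M P) (I : Finset α) (hI : (I : Set α) ⊆ M.E)
    (hIP : M.closure I ∈ insert M.E P) : ∏ i ∈ I, srElt M P i = 0 := by
  classical
  by_cases hex : ∃ i ∈ I, M.closure {i} ∈ insert M.E P
  · obtain ⟨i, hi, hiP⟩ := hex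
    exact Finset.prod_eq_zero hi (srElt_eq_zero hP (hI hi) hiP)
  push Not at hex
  have hinj : Set.InjOn (fun i => rayCone M {i}) (I : Set α) := by
    intro i hi j hj h
    have := rayCone_injOn (M := M) (singleton_ssubset_ground (hI hi) (hex i hi))
      (singleton_ssubset_ground (hI hj) (hex j hj)) h
    exact Set.singleton_injective this
  have := prod_srGen_eq_zero (Φ := bergmanFan M P) (I.image fun i => rayCone M {i}) (by
    intro ρ hρ
    obtain ⟨i, hi, rfl⟩ := Finset.mem_image.1 hρ
    exact rayCone_elt_mem_rays hP (hI hi) (hex i hi)) (by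
    intro hmem
    obtain ⟨J, C, hface, hσ⟩ := (mem_bergmanFan_iff hP).1 hmem
    refine hface.closure_notMem (hP.mem_insert_of_subset hIP (M.isFlat_closure J)
      (M.closure_subset_closure fun i hi => ?_))
    refine hface.mem_of_elt hP (hI hi) (hex i hi) ?_
    rw [← hσ]
    exact mem_sup_of_mem (ρ := rayCone M {i})
      (Finset.mem_image_of_mem (fun i => rayCone M {i}) hi) (eVec_mem_rayCone _))
  rw [Finset.prod_image hinj] at this
  rw [← this]
  exact Finset.prod_congr rfl fun i hi => srElt_eq_srGen hP (hI hi) (hex i hi)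

lemma Chow.hom_ext (hP : IsOrderFilter M P) {f g : Chow M P →ₐ[ℂ] B}
    (h1 : ∀ i ∈ M.E, f (xElt M P i) = g (xElt M P i))
    (h2 : ∀ F ∈ P, f (xFlat M P F) = g (xFlat M P F)) : f = g := by
  have : (f.comp ((chowMk M P).comp (srMk (bergmanFan M P)))) =
      g.comp ((chowMk M P).comp (srMk (bergmanFan M P))) := by
    apply MvPolynomial.algHom_ext
    intro ρ
    simp only [AlgHom.comp_apply]
    rcases ray_class hP ρ with ⟨F, hF, h⟩ | ⟨i, hi, h⟩
    · rw [h, h2 F hF]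
    · rw [h, h1 i hi]
  ext x
  obtain ⟨y, rfl⟩ := chowMk_surjective x
  obtain ⟨z, rfl⟩ := srMk_surjective y
  exact DFunLike.congr_fun this z

/-- The homomorphism from the Stanley-Reisner ring given by elements that satisfy the relations. -/
def ChowRel.srLift (hP : IsOrderFilter M P) {u : α → B} {v : Set α → B}
    (h : ChowRel M P u v) : SRRing (bergmanFan M P) →ₐ[ℂ] B :=
  SRRing.lift (MvPolynomial.aeval fun ρ => rayValue M P u v ρ) (by
    intro a ha
    rw [← RingHom.mem_ker]
    revert a
    rw [← SetLike.le_def, srIdeal, Ideal.span_le]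
    rintro _ ⟨s, hs, rfl⟩
    rw [SetLike.mem_coe, RingHom.mem_ker, map_prod]
    simp only [MvPolynomial.aeval_X]
    exact h.prod_rayValue_eq_zero hP s hs)

/-- When {i} spans an element of P ∪ {E}, x_i is zero by convention, and the product relation for
the one-element set makes u i zero as well. -/
lemma ChowRel.srLift_srElt (hP : IsOrderFilter M P) {u : α → B} {v : Set α → B}
    (h : ChowRel M P u v) {i : α} (hi : i ∈ M.E) : h.srLift hP (srElt M P i) = u i := by
  by_cases hiP : M.closure {i} ∈ insert M.E P
  · rw [srElt_eq_zero hP hi hiP, map_zero]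
    have := h.prod_elt {i} (by simpa using hi) (by simpa using hiP)
    rw [← this, Finset.prod_singleton]
  · rw [srElt_eq_srGen hP hi hiP, srGen_of_mem (rayCone_elt_mem_rays hP hi hiP), ChowRel.srLift,
      SRRing.lift_srMk, MvPolynomial.aeval_X, rayValue_elt hP u v hi hiP]

variable [M.Loopless]

lemma srFlat_mul_srFlat (hP : IsOrderFilter M P) {F G : Set α} (hF : F ∈ P) (hG : G ∈ P)
    (h1 : ¬ F ⊆ G) (h2 : ¬ G ⊆ F) : srFlat M P F * srFlat M P G = 0 := by
  classical
  have hsub : ∀ F ∈ P, F ⊂ M.E := fun F hF =>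
    (hP.subset_properFlats hF).1.subset_ground.ssubset_of_ne (hP.subset_properFlats hF).2.2
  have hne : rayCone M F ≠ rayCone M G := fun h =>
    h1 (subset_of_rayCone_eq (hsub F hF) h)
  have := prod_srGen_eq_zero (Φ := bergmanFan M P) {rayCone M F, rayCone M G} (by
    simp only [Finset.mem_insert, Finset.mem_singleton, forall_eq_or_imp, forall_eq]
    exact ⟨rayCone_flat_mem_rays hP hF, rayCone_flat_mem_rays hP hG⟩) (by
    intro hmem
    obtain ⟨I, C, hface, hσ⟩ := (mem_bergmanFan_iff hP).1 hmem
    have hFC : F ∈ C := hface.mem_of_flat hP hF (by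
      rw [← hσ]
      exact mem_sup_of_mem (ρ := rayCone M F) (by simp) (eVec_mem_rayCone _))
    have hGC : G ∈ C := hface.mem_of_flat hP hG (by
      rw [← hσ]
      exact mem_sup_of_mem (ρ := rayCone M G) (by simp) (eVec_mem_rayCone _))
    rcases hface.isChain.total hFC hGC with h | h
    · exact h1 h
    · exact h2 h)
  rwa [Finset.prod_pair hne, ← srFlat_eq_srGen, ← srFlat_eq_srGen] at this

lemma srElt_mul_srFlat (hP : IsOrderFilter M P) {i : α} {F : Set α} (hi : i ∈ M.E) (hF : F ∈ P)
    (h1 : i ∉ F) : srElt M P i * srFlat M P F = 0 := by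
  classical
  by_cases hiP : M.closure {i} ∈ insert M.E P
  · rw [srElt_eq_zero hP hi hiP, zero_mul]
  have hFE : F ⊂ M.E :=
    (hP.subset_properFlats hF).1.subset_ground.ssubset_of_ne (hP.subset_properFlats hF).2.2
  have hne : rayCone M {i} ≠ rayCone M F := fun h => by
    have := subset_of_rayCone_eq hFE h.symm
    obtain ⟨x, hx⟩ := (hP.subset_properFlats hF).2.1
    have hxi := this hx
    rw [Set.mem_singleton_iff] at hxi
    exact h1 (hxi ▸ hx)
  have := prod_srGen_eq_zero (Φ := bergmanFan M P) {rayCone M {i}, rayCone M F} (by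
    simp only [Finset.mem_insert, Finset.mem_singleton, forall_eq_or_imp, forall_eq]
    exact ⟨rayCone_elt_mem_rays hP hi hiP, rayCone_flat_mem_rays hP hF⟩) (by
    intro hmem
    obtain ⟨I, C, hface, hσ⟩ := (mem_bergmanFan_iff hP).1 hmem
    have hiI : i ∈ I := hface.mem_of_elt hP hi hiP (by
      rw [← hσ]
      exact mem_sup_of_mem (ρ := rayCone M {i}) (by simp) (eVec_mem_rayCone _))
    have hFC : F ∈ C := hface.mem_of_flat hP hF (by
      rw [← hσ]
      exact mem_sup_of_mem (ρ := rayCone M F) (by simp) (eVec_mem_rayCone _))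
    exact h1 (hface.subset_of_mem F hFC hiI))
  rwa [Finset.prod_pair hne, ← srElt_eq_srGen hP hi hiP, ← srFlat_eq_srGen] at this

lemma chowRel_chow (hP : IsOrderFilter M P) : ChowRel M P (xElt M P) (xFlat M P) where
  flat_mul_flat F hF G hG h1 h2 := by
    rw [xFlat, xFlat, ← map_mul, srFlat_mul_srFlat hP hF hG h1 h2, map_zero]
  elt_mul_flat i hi F hF h := by
    rw [xFlat, xElt, ← map_mul, srElt_mul_srFlat hP hi hF h, map_zero]
  prod_elt I hI hIP := by
    simp only [xElt]
    rw [← map_prod, prod_srElt hP I hI hIP, map_zero]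
  linear i hi j hj := by
    have key : ∀ i ∈ M.E, xElt M P i + flatSum P (xFlat M P) i =
        chowMk M P (srElt M P i + ∑ᶠ F ∈ {F | F ∈ P ∧ i ∈ F}, srFlat M P F) := by
      intro i hi
      rw [map_add]
      congr 1
      exact (map_flatSum (chowMk M P) hP.finite (srFlat M P) i).symm
    rw [key i hi, key j hj, ← sub_eq_zero, ← map_sub]
    apply chowMk_eq_zero
    refine Ideal.subset_span ⟨⟨i, hi⟩, ⟨j, hj⟩, ?_⟩
    rw [structureMap, map_sub, MvPolynomial.aeval_X, MvPolynomial.aeval_X]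

lemma ChowRel.srLift_srFlat (hP : IsOrderFilter M P) {u : α → B} {v : Set α → B}
    (h : ChowRel M P u v) {F : Set α} (hF : F ∈ P) : h.srLift hP (srFlat M P F) = v F := by
  rw [srFlat_eq_srGen, srGen_of_mem (rayCone_flat_mem_rays hP hF), ChowRel.srLift,
    SRRing.lift_srMk, MvPolynomial.aeval_X, rayValue_flat hP u v hF]

/-- The homomorphism from the Chow ring given by elements that satisfy the relations. -/
def ChowRel.lift (hP : IsOrderFilter M P) {u : α → B} {v : Set α → B}
    (h : ChowRel M P u v) : Chow M P →ₐ[ℂ] B :=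
  Chow.liftSR (h.srLift hP) (by
    have key : ∀ i : M.E, h.srLift hP (structureMap M P (MvPolynomial.X i)) =
        u i + flatSum P v i := by
      intro i
      rw [structureMap, MvPolynomial.aeval_X, map_add, h.srLift_srElt hP i.2]
      congr 1
      exact (map_flatSum (h.srLift hP) hP.finite (srFlat M P) i).trans
        (flatSum_congr (fun F hF => h.srLift_srFlat hP hF) _)
    intro a ha
    rw [← RingHom.mem_ker]
    revert a
    rw [← SetLike.le_def, linearIdeal, Ideal.span_le]
    rintro _ ⟨i, j, rfl⟩
    rw [SetLike.mem_coe, RingHom.mem_ker, map_sub, map_sub, key, key, h.linear i i.2 j j.2,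
      sub_self])

lemma ChowRel.lift_xFlat (hP : IsOrderFilter M P) {u : α → B} {v : Set α → B}
    (h : ChowRel M P u v) {F : Set α} (hF : F ∈ P) : h.lift hP (xFlat M P F) = v F := by
  rw [ChowRel.lift, xFlat, Chow.liftSR_chowMk, h.srLift_srFlat hP hF]

lemma ChowRel.lift_xElt (hP : IsOrderFilter M P) {u : α → B} {v : Set α → B}
    (h : ChowRel M P u v) {i : α} (hi : i ∈ M.E) : h.lift hP (xElt M P i) = u i := by
  rw [ChowRel.lift, xElt, Chow.liftSR_chowMk, h.srLift_srElt hP hi]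

end ChowLift

/-! ### The center of a flip -/

namespace IsMatroidalFlip

variable {M : Matroid α} {Pm Pp : Set (Set α)} {Z : Set α} (h : IsMatroidalFlip M Pm Pp Z)

include h

lemma center_mem : Z ∈ Pp := h.eq_insert ▸ Set.mem_insert Z Pm

lemma minus_subset : Pm ⊆ Pp := h.eq_insert ▸ Set.subset_insert Z Pm

lemma center_mem_properFlats : Z ∈ properFlats M := h.filter_plus.subset_properFlats h.center_mem

lemma center_subset : Z ⊆ M.E := h.center_mem_properFlats.1.subset_ground

lemma closure_center : M.closure Z = Z := h.center_mem_properFlats.1.closure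

/-- Otherwise the filter property would put Z in `Pm`. Thus Z is minimal in `Pp`. -/
lemma not_subset_center {F : Set α} (hF : F ∈ Pm) : ¬ F ⊆ Z := fun hFZ =>
  h.center_notMem (h.filter_minus.mem_of_subset F hF Z h.center_mem_properFlats hFZ)

lemma mem_minus {F : Set α} (hF : F ∈ properFlats M) (hZF : Z ⊂ F) : F ∈ Pm := by
  have := h.filter_plus.mem_of_subset Z h.center_mem F hF hZF.1
  rw [h.eq_insert] at this
  exact this.resolve_left hZF.ne'

lemma mem_plus_cases {F : Set α} (hF : F ∈ Pp) : F = Z ∨ F ∈ Pm := by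
  rwa [h.eq_insert] at hF

lemma closure_notMem {I : Set α} (hI : I ⊆ Z) : M.closure I ∉ insert M.E Pm := by
  have hcl : M.closure I ⊆ Z := h.closure_center ▸ M.closure_subset_closure hI
  rintro (hE | hmem)
  · exact h.center_mem_properFlats.2.2 (h.center_subset.antisymm (hE ▸ hcl))
  · exact h.not_subset_center hmem hcl

/-- The flip adds product relations only for the sets that span Z; subsets of Z give none for `Pm`.
-/
lemma closure_eq_center {I : Set α} (hI : I ⊆ Z) (hcl : M.closure I ∈ insert M.E Pp) :
    M.closure I = Z := by
  have := h.closure_notMem hI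
  rcases hcl with hE | hmem
  · exact absurd (Or.inl hE) this
  · rcases h.mem_plus_cases hmem with hZ | hm
    · exact hZ
    · exact absurd (Or.inr hm) this

lemma exists_notMem_center : ∃ j ∈ M.E, j ∉ Z := by
  by_contra hcon
  push Not at hcon
  exact h.center_mem_properFlats.2.2 (h.center_subset.antisymm hcon)

lemma finite_restrict [M.Finite] : (M.restrict Z).Finite :=
  ⟨M.ground_finite.subset h.center_subset⟩

lemma loopless_restrict [M.Loopless] : (M.restrict Z).Loopless :=
  (Matroid.restrict_isRestriction M Z h.center_subset).loopless

lemma loopless_contract : (M.contract Z).Loopless := by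
  refine ⟨?_⟩
  rw [Matroid.loops, Matroid.contract_closure_eq, Set.empty_union, h.closure_center, Set.sdiff_self]

lemma closure_restrict {I : Set α} (hI : I ⊆ Z) : (M.restrict Z).closure I = M.closure I := by
  rw [M.restrict_closure_eq hI h.center_subset, Set.inter_eq_left]
  exact h.closure_center ▸ M.closure_subset_closure hI

/-- Flats of the contraction correspond to flats of M above Z, and `Pm` contains every proper one
strictly above Z because `Pp` is a filter. -/
lemma bijOn_diff_center :
    Set.BijOn (· \ Z) {F | F ∈ Pm ∧ Z ⊆ F} (properFlats (M.contract Z)) := by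
  refine ⟨?_, ?_, ?_⟩
  · rintro F ⟨hF, hZF⟩
    have hFp := h.filter_minus.subset_properFlats hF
    refine ⟨?_, ?_, ?_⟩
    · rw [Matroid.isFlat_iff_closure_eq, Matroid.contract_closure_eq, Set.sdiff_union_of_subset hZF,
        hFp.1.closure]
    · rw [Set.sdiff_nonempty]
      exact h.not_subset_center hF
    · intro hE
      replace hE : F \ Z = M.E \ Z := hE
      refine hFp.2.2 ?_
      rw [← Set.sdiff_union_of_subset hZF, hE, Set.sdiff_union_of_subset h.center_subset]
  · rintro F ⟨-, hF⟩ G ⟨-, hG⟩ (hFG : F \ Z = G \ Z)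
    rw [← Set.sdiff_union_of_subset hF, hFG, Set.sdiff_union_of_subset hG]
  · rintro G ⟨hG, hne, hGE⟩
    have hGs := hG.subset_ground
    rw [Matroid.contract_ground] at hGs hGE
    have hd : Disjoint G Z := Set.disjoint_of_subset_left hGs Set.disjoint_sdiff_left
    have hdiff : (G ∪ Z) \ Z = G := by rw [Set.union_sdiff_right, hd.sdiff_eq_left]
    have hcl := hG.closure
    rw [Matroid.contract_closure_eq] at hcl
    refine ⟨G ∪ Z, ⟨h.mem_minus ⟨?_, ?_, ?_⟩ ?_, Set.subset_union_right⟩, hdiff⟩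
    · rw [Matroid.isFlat_iff_closure_eq]
      have hsub : Z ⊆ M.closure (G ∪ Z) :=
        M.subset_closure_of_subset' Set.subset_union_right h.center_subset
      rw [← Set.sdiff_union_of_subset hsub, hcl]
    · exact hne.mono Set.subset_union_left
    · intro hE
      apply hGE
      rw [← hE, hdiff]
    · refine Set.subset_union_right.ssubset_of_ne fun hZ => ?_
      rw [← hZ, Set.sdiff_self] at hdiff
      exact hne.ne_empty hdiff.symm

lemma union_mem {G : Set α} (hG : G ∈ properFlats (M.contract Z)) :
    G ∪ Z ∈ Pm ∧ (G ∪ Z) \ Z = G := by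
  obtain ⟨F, ⟨hF, hZF⟩, rfl⟩ := h.bijOn_diff_center.surjOn hG
  simp only [Set.sdiff_union_of_subset hZF]
  exact ⟨hF, trivial⟩

lemma diff_mem {F : Set α} (hF : F ∈ Pm) (hZF : Z ⊆ F) : F \ Z ∈ properFlats (M.contract Z) :=
  h.bijOn_diff_center.mapsTo ⟨hF, hZF⟩

variable {B : Type*} [CommRing B]

open Classical in
lemma flatSum_plus [M.Finite] (v : Set α → B) (i : α) :
    flatSum Pp v i = flatSum Pm v i + if i ∈ Z then v Z else 0 := by
  rw [flatSum, flatSum]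
  split_ifs with hi
  · have : {F | F ∈ Pp ∧ i ∈ F} = insert Z {F | F ∈ Pm ∧ i ∈ F} := by
      ext F
      simp only [h.eq_insert, Set.mem_insert_iff, Set.mem_ofPred_eq]
      constructor
      · rintro ⟨rfl | hF, hiF⟩
        · exact Or.inl rfl
        · exact Or.inr ⟨hF, hiF⟩
      · rintro (rfl | hF)
        · exact ⟨Or.inl rfl, hi⟩
        · exact ⟨Or.inr hF.1, hF.2⟩
    rw [this, finsum_mem_insert _ (fun hc => h.center_notMem hc.1)
      (h.filter_minus.finite.subset fun F hF => hF.1), add_comm]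
  · have : {F | F ∈ Pp ∧ i ∈ F} = {F | F ∈ Pm ∧ i ∈ F} := by
      ext F
      simp only [h.eq_insert, Set.mem_insert_iff, Set.mem_ofPred_eq]
      constructor
      · rintro ⟨rfl | hF, hiF⟩
        · exact absurd hiF hi
        · exact ⟨hF, hiF⟩
      · rintro hF
        exact ⟨Or.inr hF.1, hF.2⟩
    rw [this, add_zero]

lemma flatSum_minus_of_notMem {v : Set α → B} (hv : ∀ F ∈ Pm, ¬ Z ⊆ F → v F = 0) {i : α}
    (hi : i ∉ Z) :
    flatSum Pm v i = flatSum (properFlats (M.contract Z)) (fun G => v (G ∪ Z)) i := by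
  rw [flatSum, flatSum]
  rw [finsum_mem_inter_support_eq v {F | F ∈ Pm ∧ i ∈ F} {F | (F ∈ Pm ∧ Z ⊆ F) ∧ i ∈ F}]
  · refine finsum_mem_eq_of_bijOn (· \ Z) ⟨?_, ?_, ?_⟩ ?_
    · rintro F ⟨hF, hiF⟩
      exact ⟨h.bijOn_diff_center.mapsTo hF, hiF, hi⟩
    · exact h.bijOn_diff_center.injOn.mono fun F hF => hF.1
    · rintro G ⟨hG, hiG⟩
      obtain ⟨F, hF, rfl⟩ := h.bijOn_diff_center.surjOn hG
      exact ⟨F, ⟨hF, hiG.1⟩, rfl⟩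
    · rintro F ⟨⟨-, hF⟩, -⟩
      simp only [Set.sdiff_union_of_subset hF]
  · ext F
    simp only [Set.mem_inter_iff, Set.mem_ofPred_eq, Function.mem_support]
    constructor
    · rintro ⟨⟨hF, hiF⟩, hvF⟩
      refine ⟨⟨⟨hF, ?_⟩, hiF⟩, hvF⟩
      by_contra hZF
      exact hvF (hv F hF hZF)
    · rintro ⟨⟨⟨hF, -⟩, hiF⟩, hvF⟩
      exact ⟨⟨hF, hiF⟩, hvF⟩

/-- Every flat above Z contains i, so no summand is lost and the value is the same for all i in Z.
-/
lemma flatSum_minus_of_mem {v : Set α → B} (hv : ∀ F ∈ Pm, ¬ Z ⊆ F → v F = 0) {i : α}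
    (hi : i ∈ Z) :
    flatSum Pm v i = ∑ᶠ G ∈ properFlats (M.contract Z), v (G ∪ Z) := by
  rw [flatSum]
  rw [finsum_mem_inter_support_eq v {F | F ∈ Pm ∧ i ∈ F} {F | F ∈ Pm ∧ Z ⊆ F}]
  · refine finsum_mem_eq_of_bijOn (· \ Z) h.bijOn_diff_center ?_
    rintro F ⟨-, hF⟩
    simp only [Set.sdiff_union_of_subset hF]
  · ext F
    simp only [Set.mem_inter_iff, Set.mem_ofPred_eq, Function.mem_support]
    constructor
    · rintro ⟨⟨hF, hiF⟩, hvF⟩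
      refine ⟨⟨hF, ?_⟩, hvF⟩
      by_contra hZF
      exact hvF (hv F hF hZF)
    · rintro ⟨⟨hF, hZF⟩, hvF⟩
      exact ⟨⟨hF, hZF hi⟩, hvF⟩

/-- Relations for `A(M_Z)` in a ring where only the flats above the center survive. -/
lemma chowRel_contract {u : α → B} {v : Set α → B}
    (hmul : ∀ F ∈ Pm, ∀ G ∈ Pm, ¬ F ⊆ G → ¬ G ⊆ F → v F * v G = 0)
    (hlin : ∀ i ∈ M.E \ Z, ∀ j ∈ M.E \ Z, u i + flatSum Pm v i = u j + flatSum Pm v j)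
    (hu : ∀ i ∈ M.E \ Z, u i = 0) (hv : ∀ F ∈ Pm, ¬ Z ⊆ F → v F = 0) :
    ChowRel (M.contract Z) (properFlats (M.contract Z)) (fun _ => (0 : B))
      (fun G => v (G ∪ Z)) where
  flat_mul_flat F hF G hG h1 h2 := by
    obtain ⟨hF', hFd⟩ := h.union_mem hF
    obtain ⟨hG', hGd⟩ := h.union_mem hG
    refine hmul _ hF' _ hG' (fun hs => h1 ?_) (fun hs => h2 ?_)
    · rw [← hFd, ← hGd]
      exact Set.sdiff_subset_sdiff_left hs
    · rw [← hFd, ← hGd]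
      exact Set.sdiff_subset_sdiff_left hs
  elt_mul_flat _ _ _ _ _ := zero_mul _
  prod_elt I hI hcl := by
    -- The empty product is 1, so it must not be a relation: ∅ is closed in the contraction and is
    -- neither the ground set nor a nonempty flat.
    rcases I.eq_empty_or_nonempty with rfl | ⟨i, hi⟩
    · exfalso
      have h0 : (M.contract Z).closure ∅ = ∅ := h.loopless_contract.loops_eq_empty
      rw [Finset.coe_empty, h0] at hcl
      rcases hcl with hE | hmem
      · rw [Matroid.contract_ground] at hE
        obtain ⟨j, hj, hjZ⟩ := h.exists_notMem_center
        exact (hE ▸ (⟨hj, hjZ⟩ : j ∈ M.E \ Z) : j ∈ (∅ : Set α))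
      · exact hmem.2.1.ne_empty rfl
    · exact Finset.prod_eq_zero hi rfl
  linear i hi j hj := by
    rw [Matroid.contract_ground] at hi hj
    have := hlin i hi j hj
    rw [hu i hi, hu j hj, h.flatSum_minus_of_notMem hv hi.2,
      h.flatSum_minus_of_notMem hv hj.2] at this
    exact this

end IsMatroidalFlip

/-! ### Transporting the relations of the Chow ring -/

/-- A factor that annihilates all the shifts makes them invisible. It is applied with a = x_j for j
outside Z and shifts by multiples of x_Z. -/
lemma mul_prod_add_eq {B ι : Type*} [CommRing B] (s : Finset ι) (a : B) (u c : ι → B)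
    (hc : ∀ i ∈ s, a * c i = 0) : a * ∏ i ∈ s, (u i + c i) = a * ∏ i ∈ s, u i := by
  classical
  induction s using Finset.induction_on with
  | empty => simp
  | insert i s his ih =>
    have ih' := ih fun j hj => hc j (Finset.mem_insert_of_mem hj)
    rw [Finset.prod_insert his, Finset.prod_insert his]
    linear_combination (u i + c i) * ih' + (∏ j ∈ s, u j) * hc i (Finset.mem_insert_self i s)

lemma ChowRel.map {M : Matroid α} {P : Set (Set α)} {B B' : Type*} [CommRing B] [CommRing B']
    {u : α → B} {v : Set α → B} (h : ChowRel M P u v) (hP : P.Finite) (f : B →+* B') :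
    ChowRel M P (fun i => f (u i)) (fun F => f (v F)) where
  flat_mul_flat F hF G hG h1 h2 := by
    rw [← map_mul, h.flat_mul_flat F hF G hG h1 h2, map_zero]
  elt_mul_flat i hi F hF h1 := by rw [← map_mul, h.elt_mul_flat i hi F hF h1, map_zero]
  prod_elt I hI h1 := by rw [← map_prod, h.prod_elt I hI h1, map_zero]
  linear i hi j hj := by
    rw [← map_flatSum f hP v, ← map_flatSum f hP v, ← map_add, ← map_add, h.linear i hi j hj]

/-- For a homomorphism out of a Chow ring, the values on the `x_F` and on one `x_j` suffice. -/
lemma Chow.hom_ext_of_flats {M : Matroid α} [M.Finite] [M.Loopless] {P : Set (Set α)}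
    (hP : IsOrderFilter M P)
    {B : Type*} [CommRing B] [Algebra ℂ B] {f g : Chow M P →ₐ[ℂ] B} {j : α} (hj : j ∈ M.E)
    (h1 : f (xElt M P j) = g (xElt M P j))
    (h2 : ∀ F ∈ P, f (xFlat M P F) = g (xFlat M P F)) : f = g := by
  refine Chow.hom_ext hP (fun i hi => ?_) h2
  have hf := ((chowRel_chow hP).map hP.finite (f : Chow M P →+* B)).linear i hi j hj
  have hg := ((chowRel_chow hP).map hP.finite (g : Chow M P →+* B)).linear i hi j hj
  simp only [RingHom.coe_coe] at hf hg
  have e1 := flatSum_congr h2 i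
  have e2 := flatSum_congr h2 j
  linear_combination hf - hg - e1 + e2 + h1

lemma chowMk_C {M : Matroid α} {P : Set (Set α)} (c : ℂ) :
    chowMk M P (srMk _ (MvPolynomial.C c)) = algebraMap ℂ (Chow M P) c := by
  rw [← MvPolynomial.algebraMap_eq, AlgHom.commutes, AlgHom.commutes]

lemma Chow.eq_top_of_mem {M : Matroid α} [M.Finite] {P : Set (Set α)}
    (hP : IsOrderFilter M P) (S : Subalgebra ℂ (Chow M P)) (h1 : ∀ i ∈ M.E, xElt M P i ∈ S)
    (h2 : ∀ F ∈ P, xFlat M P F ∈ S) (y : Chow M P) : y ∈ S := by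
  obtain ⟨z, rfl⟩ := chowMk_surjective y
  obtain ⟨q, rfl⟩ := srMk_surjective z
  induction q using MvPolynomial.induction_on with
  | C a =>
    rw [chowMk_C]
    exact S.algebraMap_mem a
  | add p q hp hq => rw [map_add, map_add]; exact S.add_mem hp hq
  | mul_X p ρ hp =>
    rw [map_mul, map_mul]
    refine S.mul_mem hp ?_
    rcases ray_class hP ρ with ⟨F, hF, h⟩ | ⟨i, hi, h⟩
    · rw [h]; exact h2 F hF
    · rw [h]; exact h1 i hi

/-! ### Degrees -/

section Degrees

variable {M : Matroid α} {P : Set (Set α)}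

lemma srGen_mem_gradedPiece (ρ : PointedCone ℝ (Ambient M)) :
    chowMk M P (srGen (bergmanFan M P) ρ) ∈ gradedPiece M P 1 := by
  rw [srGen]
  split_ifs with hρ
  · exact Submodule.mem_map_of_mem (MvPolynomial.isHomogeneous_X ℂ _)
  · rw [map_zero]
    exact Submodule.zero_mem _

lemma xFlat_mem_gradedPiece (F : Set α) : xFlat M P F ∈ gradedPiece M P 1 :=
  srGen_mem_gradedPiece _

lemma xElt_mem_gradedPiece (i : α) : xElt M P i ∈ gradedPiece M P 1 := by
  rw [xElt, srElt]
  split_ifs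
  · exact srGen_mem_gradedPiece _
  · rw [map_zero]
    exact Submodule.zero_mem _

lemma one_mem_gradedPiece : (1 : Chow M P) ∈ gradedPiece M P 0 :=
  ⟨1, MvPolynomial.isHomogeneous_one _ ℂ, map_one ((chowMk M P).comp (srMk (bergmanFan M P)))⟩

lemma mul_mem_gradedPiece {s t : ℕ} {a b : Chow M P} (ha : a ∈ gradedPiece M P s)
    (hb : b ∈ gradedPiece M P t) : a * b ∈ gradedPiece M P (s + t) := by
  obtain ⟨p, hp, rfl⟩ := ha
  obtain ⟨q, hq, rfl⟩ := hb
  exact ⟨p * q, MvPolynomial.IsHomogeneous.mul hp hq,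
    map_mul ((chowMk M P).comp (srMk (bergmanFan M P))) p q⟩

/-- A homomorphism out of a Chow ring preserves degrees if it does so on the generators. -/
lemma map_mem_of_mem_gradedPiece [M.Finite] (hP : IsOrderFilter M P) {B : Type*} [CommRing B]
    [Algebra ℂ B] (f : Chow M P →ₐ[ℂ] B) (𝓑 : ℕ → Submodule ℂ B) (h1 : (1 : B) ∈ 𝓑 0)
    (hmul : ∀ s t, ∀ a ∈ 𝓑 s, ∀ b ∈ 𝓑 t, a * b ∈ 𝓑 (s + t))
    (hx : ∀ i ∈ M.E, f (xElt M P i) ∈ 𝓑 1) (hF : ∀ F ∈ P, f (xFlat M P F) ∈ 𝓑 1)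
    {s : ℕ} {a : Chow M P} (ha : a ∈ gradedPiece M P s) : f a ∈ 𝓑 s := by
  obtain ⟨q, hq, rfl⟩ := ha
  set φ : MvPolynomial (rays (bergmanFan M P)) ℂ →ₐ[ℂ] B :=
    f.comp ((chowMk M P).comp (srMk (bergmanFan M P))) with hφ
  have hX : ∀ ρ, φ (MvPolynomial.X ρ) ∈ 𝓑 1 := by
    intro ρ
    rcases ray_class hP ρ with ⟨F, hF', h⟩ | ⟨i, hi, h⟩
    · rw [hφ, AlgHom.comp_apply, AlgHom.comp_apply, h]
      exact hF F hF'
    · rw [hφ, AlgHom.comp_apply, AlgHom.comp_apply, h]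
      exact hx i hi
  have hmon : ∀ d : rays (bergmanFan M P) →₀ ℕ, φ (MvPolynomial.monomial d 1) ∈ 𝓑 d.degree := by
    intro d
    induction d using Finsupp.induction_linear with
    | zero => simpa using h1
    | add d e hd he =>
      rw [map_add, ← mul_one (1 : ℂ), ← MvPolynomial.monomial_mul, map_mul]
      exact hmul _ _ _ hd _ he
    | single ρ n =>
      rw [← MvPolynomial.X_pow_eq_monomial, map_pow, Finsupp.degree_single]
      induction n with
      | zero => simpa using h1
      | succ n ih => rw [pow_succ]; exact hmul _ _ _ ih _ (hX ρ)
  change φ q ∈ 𝓑 s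
  rw [q.as_sum, map_sum]
  refine Submodule.sum_mem _ fun d hd => ?_
  have : MvPolynomial.monomial d (q.coeff d) = q.coeff d • MvPolynomial.monomial d (1 : ℂ) := by
    rw [MvPolynomial.smul_monomial, smul_eq_mul, mul_one]
  rw [this, map_smul]
  refine Submodule.smul_mem _ _ ?_
  have hdeg : d.degree = s := by
    by_contra hne
    exact MvPolynomial.mem_support_iff.1 hd (MvPolynomial.IsHomogeneous.coeff_eq_zero hq hne)
  exact hdeg ▸ hmon d

end Degrees

/-! ### Relations carried across the flip. -/

namespace IsMatroidalFlip

variable {M : Matroid α} {Pm Pp : Set (Set α)} {Z : Set α}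
  (h : IsMatroidalFlip M Pm Pp Z) {B : Type*} [CommRing B]

include h

lemma ne_center {F : Set α} (hF : F ∈ Pm) : F ≠ Z := fun hFZ => h.not_subset_center hF hFZ.le

lemma nonempty_of_closure_eq [M.Loopless] {I : Finset α} (hcl : M.closure I = Z) : I.Nonempty := by
  rw [Finset.nonempty_iff_ne_empty]
  rintro rfl
  have : M.closure ∅ = ∅ := M.loops_eq_empty
  rw [Finset.coe_empty, this] at hcl
  exact h.center_mem_properFlats.2.1.ne_empty hcl.symm

/-- Relations for `A(M^Z, ∅)`. -/
lemma chowRel_restrict {u : α → B} {v : Set α → B} (h1 : ∀ i ∈ Z, ∀ j ∈ Z, u i = u j)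
    (h2 : ∀ I : Finset α, (I : Set α) ⊆ Z → M.closure I = Z → ∏ i ∈ I, u i = 0) :
    ChowRel (M.restrict Z) ∅ u v where
  flat_mul_flat _ hF := absurd hF (Set.notMem_empty _)
  elt_mul_flat _ _ _ hF := absurd hF (Set.notMem_empty _)
  prod_elt I hI hcl := by
    rw [Matroid.restrict_ground_eq] at hI hcl
    rw [h.closure_restrict hI] at hcl
    exact h2 I hI (by simpa using hcl)
  linear i hi j hj := by
    have : ∀ i, flatSum ∅ v i = 0 := fun i => by simp [flatSum]
    rw [this, this, h1 i hi j hj]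

variable [M.Finite]

/-- For the full filter, the closure of {i} is either the ground set or a member of the filter, so
the product relation for {i} applies. -/
lemma xElt_contract_eq_zero {i : α} (hi : i ∈ M.E \ Z) :
    xElt (M.contract Z) (properFlats (M.contract Z)) i = 0 := by
  have := h.loopless_contract
  have h1 := (chowRel_chow (isOrderFilter_properFlats (M.contract Z))).prod_elt {i}
    (by simpa using hi) ?_
  · simpa using h1
  · rw [Finset.coe_singleton]
    by_cases hE : (M.contract Z).closure {i} = (M.contract Z).E
    · exact Or.inl hE
    · refine Or.inr ⟨Matroid.isFlat_closure _, ⟨i, ?_⟩, hE⟩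
      exact Matroid.mem_closure_of_mem' _ rfl (by simpa using hi)

open Classical in
/-- Pulling back along the flip: the relations for `𝓟₊` imply those for `𝓟₋`. -/
lemma chowRel_minus {u : α → B} {v : Set α → B} (hr : ChowRel M Pp u v) :
    ChowRel M Pm (fun i => u i + if i ∈ Z then v Z else 0) v where
  flat_mul_flat F hF G hG h1 h2 :=
    hr.flat_mul_flat F (h.minus_subset hF) G (h.minus_subset hG) h1 h2
  elt_mul_flat i hi F hF hiF := by
    rw [add_mul, hr.elt_mul_flat i hi F (h.minus_subset hF) hiF, zero_add]
    split_ifs with hiZ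
    · exact hr.flat_mul_flat Z h.center_mem F (h.minus_subset hF) (fun hs => hiF (hs hiZ))
        (h.not_subset_center hF)
    · exact zero_mul _
  prod_elt I hI hcl := by
    -- The monomial has a factor x_j with j outside Z. Since x_j x_Z = 0, the shifts by x_Z in the
    -- other factors do not matter.
    have hIZ : ¬ (I : Set α) ⊆ Z := fun hs => h.closure_notMem hs hcl
    obtain ⟨j, hj, hjZ⟩ := Set.not_subset.1 hIZ
    rw [Finset.mem_coe] at hj
    have hcl' : M.closure I ∈ insert M.E Pp := Set.insert_subset_insert h.minus_subset hcl
    rw [← Finset.mul_prod_erase I _ hj, if_neg hjZ, add_zero, mul_prod_add_eq,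
      Finset.mul_prod_erase I u hj, hr.prod_elt I hI hcl']
    intro i _
    split_ifs with hiZ
    · exact hr.elt_mul_flat j (hI hj) Z h.center_mem hjZ
    · exact mul_zero _
  linear i hi j hj := by
    have := hr.linear i hi j hj
    -- The shift of x_i by x_Z is exactly the summand that the flat sum loses when Z leaves the
    -- filter.
    rw [h.flatSum_plus, h.flatSum_plus] at this
    linear_combination this

open Classical in
/-- Extending over the flip: the relations for `𝓟₋` imply those for `𝓟₊`, given a suitable value
`t` for `x_Z`. -/
lemma chowRel_plus {u : α → B} {v : Set α → B} (hr : ChowRel M Pm u v) (t : B)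
    (ht1 : ∀ j ∈ M.E \ Z, u j * t = 0) (ht2 : ∀ F ∈ Pm, ¬ Z ⊆ F → v F * t = 0)
    (ht3 : ∀ I : Finset α, (I : Set α) ⊆ Z → M.closure I = Z → ∏ i ∈ I, (u i - t) = 0) :
    ChowRel M Pp (fun i => u i - if i ∈ Z then t else 0) (fun F => if F = Z then t else v F) where
  flat_mul_flat F hF G hG h1 h2 := by
    rcases h.mem_plus_cases hF with rfl | hF'
    · rcases h.mem_plus_cases hG with rfl | hG'
      · exact absurd subset_rfl h1
      · rw [if_pos rfl, if_neg (fun hGZ => h2 hGZ.le), mul_comm]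
        exact ht2 G hG' h1
    · rcases h.mem_plus_cases hG with rfl | hG'
      · rw [if_pos rfl, if_neg (fun hFZ => h1 hFZ.le)]
        exact ht2 F hF' h2
      · rw [if_neg (h.ne_center hF'),
          if_neg (h.ne_center hG')]
        exact hr.flat_mul_flat F hF' G hG' h1 h2
  elt_mul_flat i hi F hF hiF := by
    rcases h.mem_plus_cases hF with rfl | hF'
    · rw [if_neg hiF, if_pos rfl, sub_zero]
      exact ht1 i ⟨hi, hiF⟩
    · rw [if_neg (h.ne_center hF'), sub_mul,
        hr.elt_mul_flat i hi F hF' hiF, zero_sub, neg_eq_zero]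
      split_ifs with hiZ
      · rw [mul_comm]
        exact ht2 F hF' fun hs => hiF (hs hiZ)
      · exact zero_mul _
  prod_elt I hI hcl := by
    -- Inside Z the set must span Z, which is the case of `ht3`. Otherwise it already gives a
    -- relation for `Pm`, and its factor from outside Z annihilates t.
    by_cases hIZ : (I : Set α) ⊆ Z
    · rw [← ht3 I hIZ (h.closure_eq_center hIZ hcl)]
      exact Finset.prod_congr rfl fun i hi => by rw [if_pos (hIZ hi)]
    · obtain ⟨j, hj, hjZ⟩ := Set.not_subset.1 hIZ
      rw [Finset.mem_coe] at hj
      have hcl' : M.closure I ∈ insert M.E Pm := by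
        rcases hcl with hE | hmem
        · exact Or.inl hE
        · refine Or.inr ((h.mem_plus_cases hmem).resolve_left fun hZ => hIZ ?_)
          exact hZ ▸ M.subset_closure I hI
      simp only [sub_eq_add_neg]
      rw [← Finset.mul_prod_erase I _ hj, if_neg hjZ, neg_zero, add_zero, mul_prod_add_eq,
        Finset.mul_prod_erase I u hj, hr.prod_elt I hI hcl']
      intro i _
      split_ifs with hiZ
      · rw [mul_neg, ht1 j ⟨hI hj, hjZ⟩, neg_zero]
      · rw [neg_zero, mul_zero]
  linear i hi j hj := by
    have := hr.linear i hi j hj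
    rw [h.flatSum_plus, h.flatSum_plus, if_pos rfl]
    have key : ∀ i, flatSum Pm (fun F => if F = Z then t else v F) i = flatSum Pm v i := fun i =>
      flatSum_congr (fun F hF => if_neg (h.ne_center hF)) i
    rw [key, key]
    linear_combination this

open Classical in
/-- The relations for `𝓟₋` in `A(M_Z)`. -/
lemma exists_chowRel_link : ∃ γ ∈ gradedPiece (M.contract Z) (properFlats (M.contract Z)) 1,
    ChowRel M Pm (fun i => if i ∈ Z then γ else 0) (fun F => if Z ⊆ F then
      xFlat (M.contract Z) (properFlats (M.contract Z)) (F \ Z) else 0) := by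
  have := h.loopless_contract
  set N := M.contract Z
  have hN := chowRel_chow (isOrderFilter_properFlats N)
  obtain ⟨j₀, hj₀⟩ := h.exists_notMem_center
  have hind : ∀ i ∈ M.E \ Z, flatSum (properFlats N) (xFlat N (properFlats N)) i =
      flatSum (properFlats N) (xFlat N (properFlats N)) j₀ := by
    intro i hi
    have := hN.linear i hi j₀ hj₀
    rwa [h.xElt_contract_eq_zero hi, h.xElt_contract_eq_zero hj₀, zero_add, zero_add] at this
  have hv : ∀ F ∈ Pm, ¬ Z ⊆ F → (if Z ⊆ F then xFlat N (properFlats N) (F \ Z) else 0) = 0 :=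
    fun F _ hZF => if_neg hZF
  have hvG : ∀ G ∈ properFlats N, (if Z ⊆ G ∪ Z then
      xFlat N (properFlats N) ((G ∪ Z) \ Z) else 0) = xFlat N (properFlats N) G := by
    intro G hG
    rw [if_pos Set.subset_union_right, (h.union_mem hG).2]
  -- The linear relation between an element of Z and j₀ forces this γ: flats above Z all contain the
  -- former, and contain j₀ only when their difference with Z does.
  refine ⟨flatSum (properFlats N) (xFlat N (properFlats N)) j₀ -
    ∑ᶠ G ∈ properFlats N, xFlat N (properFlats N) G, ?_, ?_, ?_, ?_, ?_⟩
  · refine Submodule.sub_mem _ ?_ ?_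
    · exact finsum_mem_induction (· ∈ gradedPiece N (properFlats N) 1) (Submodule.zero_mem _)
        (fun _ _ => Submodule.add_mem _) fun F _ => xFlat_mem_gradedPiece F
    · exact finsum_mem_induction (· ∈ gradedPiece N (properFlats N) 1) (Submodule.zero_mem _)
        (fun _ _ => Submodule.add_mem _) fun F _ => xFlat_mem_gradedPiece F
  · intro F hF G hG h1 h2
    split_ifs with hZF hZG
    · refine hN.flat_mul_flat _ (h.diff_mem hF hZF) _ (h.diff_mem hG hZG)
        (fun hs => h1 ?_) (fun hs => h2 ?_)
      · rw [← Set.sdiff_union_of_subset hZF, ← Set.sdiff_union_of_subset hZG]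
        exact Set.union_subset_union_left Z hs
      · rw [← Set.sdiff_union_of_subset hZF, ← Set.sdiff_union_of_subset hZG]
        exact Set.union_subset_union_left Z hs
    · exact mul_zero _
    · exact zero_mul _
    · exact zero_mul _
  · intro i hi F hF hiF
    split_ifs with hiZ hZF
    · exact absurd (hZF hiZ) hiF
    · exact mul_zero _
    · exact zero_mul _
    · exact zero_mul _
  · intro I hI hcl
    have hIZ : ¬ (I : Set α) ⊆ Z := fun hs => h.closure_notMem hs hcl
    obtain ⟨j, hj, hjZ⟩ := Set.not_subset.1 hIZ
    exact Finset.prod_eq_zero hj (if_neg hjZ)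
  · have key : ∀ i ∈ M.E, ((if i ∈ Z then flatSum (properFlats N) (xFlat N (properFlats N)) j₀ -
        ∑ᶠ G ∈ properFlats N, xFlat N (properFlats N) G else 0) + flatSum Pm (fun F => if Z ⊆ F then
        xFlat N (properFlats N) (F \ Z) else 0) i) =
        flatSum (properFlats N) (xFlat N (properFlats N)) j₀ := by
      intro i hi
      split_ifs with hiZ
      · rw [h.flatSum_minus_of_mem hv hiZ, finsum_mem_congr rfl hvG, sub_add_cancel]
      · rw [h.flatSum_minus_of_notMem hv hiZ, flatSum_congr hvG, zero_add, hind i ⟨hi, hiZ⟩]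
    intro i hi j hj
    rw [key i hi, key j hj]

variable [M.Loopless]

/-- With an empty filter there are no flat sums, and the linear relations just identify the
variables. -/
lemma xElt_restrict_eq {i j : α} (hi : i ∈ Z) (hj : j ∈ Z) :
    xElt (M.restrict Z) ∅ i = xElt (M.restrict Z) ∅ j := by
  have := h.finite_restrict
  have := h.loopless_restrict
  have h1 := (chowRel_chow (isOrderFilter_empty (M.restrict Z))).linear i hi j hj
  have : ∀ i, flatSum ∅ (xFlat (M.restrict Z) ∅) i = 0 := fun i => by simp [flatSum]
  rwa [this, this, add_zero, add_zero] at h1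

lemma prod_xElt_restrict {I : Finset α} (hI : (I : Set α) ⊆ Z) (hcl : M.closure I = Z) :
    ∏ i ∈ I, xElt (M.restrict Z) ∅ i = 0 := by
  have := h.finite_restrict
  have := h.loopless_restrict
  refine (chowRel_chow (isOrderFilter_empty (M.restrict Z))).prod_elt I hI ?_
  rw [h.closure_restrict hI]
  exact Or.inl hcl

end IsMatroidalFlip

/-! ### Augmentations -/

section Augmentation

variable {M : Matroid α} {P : Set (Set α)}

lemma gradedPiece_le_positivePart {s : ℕ} (hs : 0 < s) :
    gradedPiece M P s ≤ positivePart M P :=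
  le_iSup (fun s : {s : ℕ // 0 < s} => gradedPiece M P s) ⟨s, hs⟩

variable [M.Finite]

/-- An augmentation of a Chow ring is the constant coefficient of representing polynomials. -/
lemma augmentation_apply (hP : IsOrderFilter M P) {ε : Chow M P →ₐ[ℂ] ℂ}
    (h1 : ∀ i ∈ M.E, ε (xElt M P i) = 0) (h2 : ∀ F ∈ P, ε (xFlat M P F) = 0)
    (q : MvPolynomial (rays (bergmanFan M P)) ℂ) :
    ε (chowMk M P (srMk _ q)) = q.coeff 0 := by
  have : (ε.comp ((chowMk M P).comp (srMk (bergmanFan M P)))) = MvPolynomial.aeval fun _ => 0 := by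
    apply MvPolynomial.algHom_ext
    intro ρ
    rw [MvPolynomial.aeval_X, AlgHom.comp_apply, AlgHom.comp_apply]
    rcases ray_class hP ρ with ⟨F, hF, h⟩ | ⟨i, hi, h⟩
    · rw [h, h2 F hF]
    · rw [h, h1 i hi]
  have h3 := DFunLike.congr_fun this q
  rw [AlgHom.comp_apply, AlgHom.comp_apply] at h3
  rw [h3, ← MvPolynomial.constantCoeff_eq]
  simp

lemma augmentation_eq_zero (hP : IsOrderFilter M P) {ε : Chow M P →ₐ[ℂ] ℂ}
    (h1 : ∀ i ∈ M.E, ε (xElt M P i) = 0) (h2 : ∀ F ∈ P, ε (xFlat M P F) = 0)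
    {s : ℕ} (hs : 0 < s) {a : Chow M P} (ha : a ∈ gradedPiece M P s) : ε a = 0 := by
  obtain ⟨q, hq, rfl⟩ := ha
  refine (augmentation_apply hP h1 h2 q).trans ?_
  refine MvPolynomial.IsHomogeneous.coeff_eq_zero hq ?_
  simpa using hs.ne

lemma augmentation_eq_zero_of_mem_positivePart (hP : IsOrderFilter M P) {ε : Chow M P →ₐ[ℂ] ℂ}
    (h1 : ∀ i ∈ M.E, ε (xElt M P i) = 0) (h2 : ∀ F ∈ P, ε (xFlat M P F) = 0)
    {a : Chow M P} (ha : a ∈ positivePart M P) : ε a = 0 := by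
  have : positivePart M P ≤ LinearMap.ker ε.toLinearMap :=
    iSup_le fun s a ha => augmentation_eq_zero hP h1 h2 s.2 ha
  exact this ha

/-- Subtracting ε a removes the constant term of any representing polynomial, and its other
homogeneous components have positive degree. No directness of the grading is needed. -/
lemma sub_augmentation_mem (hP : IsOrderFilter M P) {ε : Chow M P →ₐ[ℂ] ℂ}
    (h1 : ∀ i ∈ M.E, ε (xElt M P i) = 0) (h2 : ∀ F ∈ P, ε (xFlat M P F) = 0) (a : Chow M P) :
    a - algebraMap ℂ _ (ε a) ∈ positivePart M P := by
  obtain ⟨z, rfl⟩ := chowMk_surjective a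
  obtain ⟨q, rfl⟩ := srMk_surjective z
  rw [augmentation_apply hP h1 h2, ← chowMk_C, ← map_sub, ← map_sub]
  nth_rewrite 1 [← q.sum_homogeneousComponent]
  rw [Finset.sum_range_succ', MvPolynomial.homogeneousComponent_zero, add_sub_cancel_right,
    map_sum, map_sum]
  refine Submodule.sum_mem _ fun i _ => gradedPiece_le_positivePart i.succ_pos ?_
  exact ⟨_, MvPolynomial.homogeneousComponent_isHomogeneous (i + 1) q, rfl⟩

lemma eq_augmentation (hP : IsOrderFilter M P) {ε : Chow M P →ₐ[ℂ] ℂ}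
    (h1 : ∀ i ∈ M.E, ε (xElt M P i) = 0) (h2 : ∀ F ∈ P, ε (xFlat M P F) = 0) {a : Chow M P}
    (ha : a ∈ gradedPiece M P 0) : a = algebraMap ℂ _ (ε a) := by
  obtain ⟨q, hq, rfl⟩ := ha
  have hq' : q = MvPolynomial.C (q.coeff 0) := by
    rw [← MvPolynomial.totalDegree_eq_zero_iff_eq_C]
    exact Nat.le_zero.1 (MvPolynomial.IsHomogeneous.totalDegree_le hq)
  change chowMk M P (srMk _ q) = algebraMap ℂ _ (ε (chowMk M P (srMk _ q)))
  rw [augmentation_apply hP h1 h2, ← chowMk_C, ← hq']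

/-- The projection onto the positive part along an augmentation. -/
lemma exists_projection (hP : IsOrderFilter M P) {ε : Chow M P →ₐ[ℂ] ℂ}
    (h1 : ∀ i ∈ M.E, ε (xElt M P i) = 0) (h2 : ∀ F ∈ P, ε (xFlat M P F) = 0) :
    ∃ p : Chow M P →ₗ[ℂ] positivePart M P, ∀ a, (p a : Chow M P) = a - algebraMap ℂ _ (ε a) :=
  ⟨(LinearMap.id - (Algebra.linearMap ℂ (Chow M P)).comp ε.toLinearMap).codRestrict _
    fun a => sub_augmentation_mem hP h1 h2 a, fun _ => rfl⟩

end Augmentation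

/-! ### Degrees in a tensor product of Chow rings. -/

section Tensor

/-- The homogeneous elements of degree `s` in the tensor product of two Chow rings. -/
def tensorPiece (M N : Matroid α) (P Q : Set (Set α)) (s : ℕ) :
    Submodule ℂ (Chow M P ⊗[ℂ] Chow N Q) :=
  Submodule.span ℂ {t | ∃ (s₁ s₂ : ℕ) (a : Chow M P) (b : Chow N Q), s₁ + s₂ = s ∧
    a ∈ gradedPiece M P s₁ ∧ b ∈ gradedPiece N Q s₂ ∧ t = a ⊗ₜ[ℂ] b}

variable {M N : Matroid α} {P Q : Set (Set α)}

lemma tmul_mem_tensorPiece {s₁ s₂ s : ℕ} {a : Chow M P} {b : Chow N Q}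
    (ha : a ∈ gradedPiece M P s₁) (hb : b ∈ gradedPiece N Q s₂) (hs : s₁ + s₂ = s) :
    a ⊗ₜ[ℂ] b ∈ tensorPiece M N P Q s :=
  Submodule.subset_span ⟨s₁, s₂, a, b, hs, ha, hb, rfl⟩

lemma mul_mem_tensorPiece {s t : ℕ} {x y : Chow M P ⊗[ℂ] Chow N Q}
    (hx : x ∈ tensorPiece M N P Q s) (hy : y ∈ tensorPiece M N P Q t) :
    x * y ∈ tensorPiece M N P Q (s + t) := by
  have : tensorPiece M N P Q s * tensorPiece M N P Q t ≤ tensorPiece M N P Q (s + t) := by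
    rw [tensorPiece, tensorPiece, Submodule.span_mul_span, Submodule.span_le]
    rintro _ ⟨_, ⟨s₁, s₂, a, b, rfl, ha, hb, rfl⟩, _, ⟨t₁, t₂, c, d, rfl, hc, hd, rfl⟩, rfl⟩
    simp only [Algebra.TensorProduct.tmul_mul_tmul]
    exact tmul_mem_tensorPiece (mul_mem_gradedPiece ha hc) (mul_mem_gradedPiece hb hd)
      (add_add_add_comm _ _ _ _)
  exact this (Submodule.mul_mem_mul hx hy)

end Tensor

section

/-! ### The homomorphisms of the flip sequence -/

/-- The homomorphisms attached to a flip: `ι`, `θ` and the homomorphism `link` from `A(M,𝓟₋)` to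
`A(M_Z)` with `θ ∘ ι = 1 ⊗ link`. -/
structure FlipMaps (M : Matroid α) (Pm Pp : Set (Set α)) (Z : Set α) where
  ι : Chow M Pm →ₐ[ℂ] Chow M Pp
  θ : Chow M Pp →ₐ[ℂ] FlipTensor M Z
  link : Chow M Pm →ₐ[ℂ] FullChow (M.contract Z)
  γ : FullChow (M.contract Z)
  γ_mem : γ ∈ gradedPiece (M.contract Z) (properFlats (M.contract Z)) 1
  ι_xElt_center : ∀ i ∈ Z, ι (xElt M Pm i) = xElt M Pp i + xFlat M Pp Z
  ι_xElt : ∀ i ∈ M.E \ Z, ι (xElt M Pm i) = xElt M Pp i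
  ι_xFlat : ∀ F ∈ Pm, ι (xFlat M Pm F) = xFlat M Pp F
  θ_xElt_center : ∀ i ∈ Z, θ (xElt M Pp i) = xElt (M.restrict Z) ∅ i ⊗ₜ[ℂ] 1
  θ_xElt : ∀ i ∈ M.E \ Z, θ (xElt M Pp i) = 0
  θ_center : ∀ i ∈ Z, θ (xFlat M Pp Z) = 1 ⊗ₜ[ℂ] γ - xElt (M.restrict Z) ∅ i ⊗ₜ[ℂ] 1
  link_xElt_center : ∀ i ∈ Z, link (xElt M Pm i) = γ
  link_xElt : ∀ i ∈ M.E \ Z, link (xElt M Pm i) = 0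
  link_xFlat : ∀ F ∈ Pm, Z ⊆ F → link (xFlat M Pm F) =
    xFlat (M.contract Z) (properFlats (M.contract Z)) (F \ Z)
  link_xFlat_eq_zero : ∀ F ∈ Pm, ¬ Z ⊆ F → link (xFlat M Pm F) = 0
  θ_ι : ∀ a, θ (ι a) = 1 ⊗ₜ[ℂ] link a

variable {M : Matroid α} [M.Finite] [M.Loopless] {Pm Pp : Set (Set α)} {Z : Set α}

/-- θ arises by extending 1 ⊗ link over the flip. As θ ι = 1 ⊗ link should send x_i to θ(x_i) +
θ(x_Z) for i in Z, the value at x_Z has to be 1 ⊗ γ - x_i ⊗ 1. -/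
lemma IsMatroidalFlip.nonempty_flipMaps (h : IsMatroidalFlip M Pm Pp Z) :
    Nonempty (FlipMaps M Pm Pp Z) := by
  classical
  obtain ⟨γ, hγ, hlink⟩ := h.exists_chowRel_link
  have hι := h.chowRel_minus (chowRel_chow h.filter_plus)
  obtain ⟨i₀, hi₀⟩ := h.center_mem_properFlats.2.1
  set incl : FullChow (M.contract Z) →ₐ[ℂ] FlipTensor M Z := Algebra.TensorProduct.includeRight
  have hθ := h.chowRel_plus (hlink.map h.filter_minus.finite
    (incl : FullChow (M.contract Z) →+* FlipTensor M Z))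
    (1 ⊗ₜ[ℂ] γ - xElt (M.restrict Z) ∅ i₀ ⊗ₜ[ℂ] 1) ?_ ?_ ?_
  rotate_left
  · intro j hj
    rw [if_neg hj.2, map_zero, zero_mul]
  · intro F hF hZF
    rw [if_neg hZF, map_zero, zero_mul]
  · intro I hI hcl
    -- Subtracting the value at x_Z from 1 ⊗ γ leaves x_i ⊗ 1, so the new relations are those of
    -- A(M^Z, ∅).
    have : ∀ i ∈ I, (incl : FullChow (M.contract Z) →+* FlipTensor M Z)
        (if i ∈ Z then γ else 0) -
        (1 ⊗ₜ[ℂ] γ - xElt (M.restrict Z) ∅ i₀ ⊗ₜ[ℂ] 1) =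
        (Algebra.TensorProduct.includeLeft : _ →ₐ[ℂ] FlipTensor M Z)
          (xElt (M.restrict Z) ∅ i) := by
      intro i hi
      rw [if_pos (hI hi), h.xElt_restrict_eq (hI hi) hi₀]
      exact sub_sub_cancel _ _
    rw [Finset.prod_congr rfl this, ← map_prod, h.prod_xElt_restrict hI hcl, map_zero]
  have hιe : ∀ i ∈ M.E, _ := fun i hi => hι.lift_xElt h.filter_minus hi
  have hιf : ∀ F ∈ Pm, _ := fun F hF => hι.lift_xFlat h.filter_minus hF
  have hθe : ∀ i ∈ M.E, _ := fun i hi => hθ.lift_xElt h.filter_plus hi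
  have hθf : ∀ F ∈ Pp, _ := fun F hF => hθ.lift_xFlat h.filter_plus hF
  have hle : ∀ i ∈ M.E, _ := fun i hi => hlink.lift_xElt h.filter_minus hi
  have hlf : ∀ F ∈ Pm, _ := fun F hF => hlink.lift_xFlat h.filter_minus hF
  have hZE := h.center_subset
  have hθZ := hθf Z h.center_mem
  rw [if_pos rfl] at hθZ
  refine ⟨⟨hι.lift h.filter_minus, hθ.lift h.filter_plus, hlink.lift h.filter_minus, γ, hγ,
    ?_, ?_, hιf, ?_, ?_, ?_, ?_, ?_, ?_, ?_, ?_⟩⟩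
  · intro i hi
    rw [hιe i (hZE hi), if_pos hi]
  · intro i hi
    rw [hιe i hi.1, if_neg hi.2, add_zero]
  · intro i hi
    rw [hθe i (hZE hi), if_pos hi, if_pos hi, h.xElt_restrict_eq hi hi₀]
    exact sub_sub_cancel _ _
  · intro i hi
    rw [hθe i hi.1, if_neg hi.2, if_neg hi.2, map_zero, sub_zero]
  · intro i hi
    rw [hθZ, h.xElt_restrict_eq hi hi₀]
  · intro i hi
    rw [hle i (hZE hi), if_pos hi]
  · intro i hi
    rw [hle i hi.1, if_neg hi.2]
  · intro F hF hZF
    rw [hlf F hF, if_pos hZF]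
  · intro F hF hZF
    rw [hlf F hF, if_neg hZF]
  · obtain ⟨j, hj, hjZ⟩ := h.exists_notMem_center
    have : (hθ.lift h.filter_plus).comp (hι.lift h.filter_minus) =
        incl.comp (hlink.lift h.filter_minus) := by
      refine Chow.hom_ext_of_flats h.filter_minus hj ?_ ?_
      · rw [AlgHom.comp_apply, AlgHom.comp_apply, hιe j hj, hle j hj, if_neg hjZ, if_neg hjZ,
          add_zero, hθe j hj, if_neg hjZ, if_neg hjZ, map_zero, map_zero, sub_zero]
      · intro F hF
        rw [AlgHom.comp_apply, AlgHom.comp_apply, hιf F hF, hlf F hF, hθf F (h.minus_subset hF),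
          if_neg (h.ne_center hF)]
        rfl
    exact fun a => DFunLike.congr_fun this a

namespace FlipMaps

variable (h : IsMatroidalFlip M Pm Pp Z) (f : FlipMaps M Pm Pp Z)

include h

/-- A homomorphism out of `A(M,𝓟₋)` that kills what lies away from the center factors through
`A(M_Z)`. -/
lemma exists_factor_link {Q : Type*} [CommRing Q] [Algebra ℂ Q] (π : Chow M Pm →ₐ[ℂ] Q)
    (h1 : ∀ i ∈ M.E \ Z, π (xElt M Pm i) = 0)
    (h2 : ∀ F ∈ Pm, ¬ Z ⊆ F → π (xFlat M Pm F) = 0) :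
    ∃ φ : FullChow (M.contract Z) →ₐ[ℂ] Q, ∀ a, φ (f.link a) = π a := by
  have := h.loopless_contract
  have hπ := (chowRel_chow h.filter_minus).map h.filter_minus.finite (π : Chow M Pm →+* Q)
  have hr := h.chowRel_contract hπ.flat_mul_flat
    (fun i hi j hj => hπ.linear i hi.1 j hj.1) h1 h2
  obtain ⟨j, hj, hjZ⟩ := h.exists_notMem_center
  refine ⟨hr.lift (isOrderFilter_properFlats _), ?_⟩
  have : (hr.lift (isOrderFilter_properFlats _)).comp f.link = π := by
    refine Chow.hom_ext_of_flats h.filter_minus hj ?_ ?_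
    · rw [AlgHom.comp_apply, f.link_xElt j ⟨hj, hjZ⟩, map_zero, h1 j ⟨hj, hjZ⟩]
    · intro F hF
      rw [AlgHom.comp_apply]
      by_cases hZF : Z ⊆ F
      · rw [f.link_xFlat F hF hZF, hr.lift_xFlat _ (h.diff_mem hF hZF),
          Set.sdiff_union_of_subset hZF]
        rfl
      · rw [f.link_xFlat_eq_zero F hF hZF, map_zero, h2 F hF hZF]
  exact fun a => DFunLike.congr_fun this a

/-- The quotient of A₋ by the annihilator of x^I factors through `link`. Indeed x_j x^I = 0 for j
outside Z, since I ∪ {j} spans a flat strictly above Z, and x_F x^I = 0 when F is not above Z, since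
some element of I is missing from F. -/
lemma mul_prod_eq_zero {a : Chow M Pm} (ha : f.link a = 0) {I : Finset α} (hI : (I : Set α) ⊆ Z)
    (hcl : M.closure I = Z) : a * ∏ i ∈ I, xElt M Pm i = 0 := by
  classical
  set x := ∏ i ∈ I, xElt M Pm i with hx
  have hr := chowRel_chow h.filter_minus
  set J := (Ideal.span {x}).annihilator
  have hJ : ∀ b, b ∈ J ↔ b * x = 0 := fun b => Submodule.mem_annihilator_span_singleton x b
  obtain ⟨φ, hφ⟩ := f.exists_factor_link h (Ideal.Quotient.mkₐ ℂ J) (by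
    rintro i ⟨hi, hiZ⟩
    refine Ideal.Quotient.eq_zero_iff_mem.2 ((hJ _).2 ?_)
    have hiI : i ∉ I := fun hiI => hiZ (hI hiI)
    rw [hx, ← Finset.prod_insert hiI]
    have hIE : ((insert i I : Finset α) : Set α) ⊆ M.E := by
      rw [Finset.coe_insert]
      exact Set.insert_subset hi (hI.trans h.center_subset)
    refine hr.prod_elt _ hIE ?_
    have hZc : Z ⊂ M.closure ((insert i I : Finset α) : Set α) := by
      refine ⟨hcl ▸ M.closure_subset_closure (by simp), fun hs => hiZ (hs ?_)⟩
      exact M.subset_closure _ hIE (by simp)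
    by_cases hE : M.closure ((insert i I : Finset α) : Set α) = M.E
    · exact Or.inl hE
    · exact Or.inr (h.mem_minus ⟨M.isFlat_closure _,
        h.center_mem_properFlats.2.1.mono hZc.1, hE⟩ hZc)) (by
    intro F hF hZF
    refine Ideal.Quotient.eq_zero_iff_mem.2 ((hJ _).2 ?_)
    have : ¬ (I : Set α) ⊆ F := fun hs => hZF (by
      rw [← hcl, ← (h.filter_minus.subset_properFlats hF).1.closure]
      exact M.closure_subset_closure hs)
    obtain ⟨i, hi, hiF⟩ := Set.not_subset.1 this
    rw [hx, ← Finset.mul_prod_erase I _ hi, ← mul_assoc, mul_comm (xFlat M Pm F),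
      hr.elt_mul_flat i (h.center_subset (hI hi)) F hF hiF, zero_mul])
  have := hφ a
  rw [ha, map_zero] at this
  exact (hJ a).1 (Ideal.Quotient.eq_zero_iff_mem.1 this.symm)

/-- The quotient of A₊ by the annihilator of x_Z receives a map from A(M_Z), since x_Z kills what is
away from Z. It also receives one from A(M^Z, ∅), since there all x_i with i in Z become γ - x_Z.
Together they give ψ on the tensor product with ψ ∘ θ the quotient map. -/
lemma mul_center_eq_zero {y : Chow M Pp} (hy : f.θ y = 0) : y * xFlat M Pp Z = 0 := by
  classical
  have hr := chowRel_chow h.filter_plus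
  set x := xFlat M Pp Z with hx
  set J := (Ideal.span {x}).annihilator
  have hJ : ∀ b, b ∈ J ↔ b * x = 0 := fun b => Submodule.mem_annihilator_span_singleton x b
  set π := Ideal.Quotient.mkₐ ℂ J
  have hπ : ∀ b, b * x = 0 → π b = 0 := fun b hb =>
    Ideal.Quotient.eq_zero_iff_mem.2 ((hJ b).2 hb)
  have hπe : ∀ i ∈ M.E \ Z, π (xElt M Pp i) = 0 := fun i hi =>
    hπ _ (hr.elt_mul_flat i hi.1 Z h.center_mem hi.2)
  obtain ⟨φ, hφ⟩ := f.exists_factor_link h (π.comp f.ι) (by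
    intro i hi
    rw [AlgHom.comp_apply, f.ι_xElt i hi, hπe i hi]) (by
    intro F hF hZF
    rw [AlgHom.comp_apply, f.ι_xFlat F hF]
    exact hπ _ (hr.flat_mul_flat F (h.minus_subset hF) Z h.center_mem
      (h.not_subset_center hF) hZF))
  have hφγ : ∀ i ∈ Z, π (xElt M Pp i) = φ f.γ - π x := by
    intro i hi
    have := hφ (xElt M Pm i)
    rw [f.link_xElt_center i hi, AlgHom.comp_apply, f.ι_xElt_center i hi, map_add] at this
    rw [this, add_sub_cancel_right]
  have hres : ChowRel (M.restrict Z) ∅ (fun i => π (xElt M Pp i)) (fun _ => 0) := by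
    refine h.chowRel_restrict (fun i hi j hj => by rw [hφγ i hi, hφγ j hj]) fun I hI hcl => ?_
    rw [← map_prod, hr.prod_elt I (hI.trans h.center_subset)
      (Or.inr (hcl ▸ h.center_mem)), map_zero]
  have := h.finite_restrict
  have := h.loopless_restrict
  obtain ⟨i₀, hi₀⟩ := h.center_mem_properFlats.2.1
  obtain ⟨j, hj, hjZ⟩ := h.exists_notMem_center
  set ψ : FlipTensor M Z →ₐ[ℂ] _ := Algebra.TensorProduct.lift
    (hres.lift (isOrderFilter_empty _)) φ (fun _ _ => Commute.all _ _)
  have hψ : ∀ a b, ψ (a ⊗ₜ b) = hres.lift (isOrderFilter_empty _) a * φ b := fun a b =>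
    Algebra.TensorProduct.lift_tmul _ _ _ a b
  have hψπ : ψ.comp f.θ = π := by
    refine Chow.hom_ext_of_flats h.filter_plus hj ?_ ?_
    · rw [AlgHom.comp_apply, f.θ_xElt j ⟨hj, hjZ⟩, map_zero, hπe j ⟨hj, hjZ⟩]
    · intro F hF
      rw [AlgHom.comp_apply]
      rcases h.mem_plus_cases hF with rfl | hF'
      · rw [f.θ_center i₀ hi₀, map_sub, hψ, hψ, map_one, map_one, one_mul, mul_one,
          hres.lift_xElt _ hi₀, hφγ i₀ hi₀, sub_sub_cancel]
      · rw [← f.ι_xFlat F hF', f.θ_ι, hψ, map_one, one_mul, hφ]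
        rfl
  have := DFunLike.congr_fun hψπ y
  rw [AlgHom.comp_apply, hy, map_zero] at this
  exact (hJ y).1 (Ideal.Quotient.eq_zero_iff_mem.1 this.symm)

end FlipMaps

end

section

/-! ### Injectivity of `ι` -/

variable {M : Matroid α} [M.Finite] [M.Loopless] {Pm Pp : Set (Set α)} {Z : Set α}

namespace IsMatroidalFlip

variable (h : IsMatroidalFlip M Pm Pp Z)

include h

/-- Multiply the linear relation for e and y by x^K. Only flats containing K survive, and such a
flat contains e exactly when it contains Z, likewise for y, so the flat sums cancel. -/
lemma prod_mul_xElt_eq {K : Finset α} (hK : (K : Set α) ⊆ Z) {e y : α} (he : e ∈ Z) (hy : y ∈ Z)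
    (hce : M.closure (insert e (K : Set α)) = Z) (hcy : M.closure (insert y (K : Set α)) = Z) :
    (∏ i ∈ K, xElt M Pm i) * xElt M Pm e = (∏ i ∈ K, xElt M Pm i) * xElt M Pm y := by
  classical
  have hr := chowRel_chow h.filter_minus
  set p := ∏ i ∈ K, xElt M Pm i with hp
  have hKF : ∀ F ∈ Pm, p * xFlat M Pm F ≠ 0 → (K : Set α) ⊆ F := by
    intro F hF hne i hi
    by_contra hiF
    apply hne
    rw [hp, ← Finset.mul_prod_erase K _ hi, mul_right_comm,
      hr.elt_mul_flat i (h.center_subset (hK hi)) F hF hiF, zero_mul]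
  have hZF : ∀ F ∈ Pm, ∀ e, M.closure (insert e (K : Set α)) = Z →
      p * xFlat M Pm F ≠ 0 → e ∈ F → Z ⊆ F := by
    intro F hF e hce hne heF
    rw [← hce, ← (h.filter_minus.subset_properFlats hF).1.closure]
    exact M.closure_subset_closure (Set.insert_subset heF (hKF F hF hne))
  have hsum : p * flatSum Pm (xFlat M Pm) e = p * flatSum Pm (xFlat M Pm) y := by
    have hm := map_flatSum (AddMonoidHom.mulLeft p) h.filter_minus.finite (xFlat M Pm)
    simp only [AddMonoidHom.coe_mulLeft] at hm
    rw [hm, hm, flatSum, flatSum]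
    refine finsum_mem_inter_support_eq _ _ _ ?_
    ext F
    simp only [Set.mem_inter_iff, Set.mem_ofPred_eq, Function.mem_support]
    constructor
    · rintro ⟨⟨hF, heF⟩, hne⟩
      exact ⟨⟨hF, hZF F hF e hce hne heF hy⟩, hne⟩
    · rintro ⟨⟨hF, hyF⟩, hne⟩
      exact ⟨⟨hF, hZF F hF y hcy hne hyF he⟩, hne⟩
  have hlin := hr.linear e (h.center_subset he) y (h.center_subset hy)
  linear_combination p * hlin - hsum

/-- The product of the `x_i` over a basis of the center does not depend on the basis. -/
lemma prod_xElt_eq_of_isBase {I J : Finset α} (hI : (M.restrict Z).IsBase I)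
    (hJ : (M.restrict Z).IsBase J) : ∏ i ∈ I, xElt M Pm i = ∏ i ∈ J, xElt M Pm i := by
  classical
  have hcl : ∀ B, (M.restrict Z).IsBase B → B ⊆ Z ∧ M.closure B = Z := by
    intro B hB
    have hBZ : B ⊆ Z := hB.subset_ground
    refine ⟨hBZ, ?_⟩
    rw [← h.closure_restrict hBZ, hB.closure_eq, Matroid.restrict_ground_eq]
  induction hn : (I \ J).card generalizing I with
  | zero =>
    rw [Finset.card_eq_zero, Finset.sdiff_eq_empty_iff_subset] at hn
    have := hI.eq_of_subset_isBase hJ (by exact_mod_cast hn)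
    rw [Finset.coe_inj.1 this]
  | succ n ih =>
    have hne : (I \ J).Nonempty := by
      rw [← Finset.card_pos, hn]
      exact n.succ_pos
    obtain ⟨e, he⟩ := hne
    have he' := Finset.mem_sdiff.1 he
    -- One exchange replaces e by an element of J, which lowers the size of I \ J, and keeps the
    -- product by `prod_mul_xElt_eq`.
    obtain ⟨y, hy, hyB⟩ := hI.exchange hJ (e := e) ⟨he'.1, he'.2⟩
    have hyI : y ∉ I := fun hc => hy.2 hc
    have hcoe : ((insert y (I.erase e) : Finset α) : Set α) = insert y ((I : Set α) \ {e}) := by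
      rw [Finset.coe_insert, Finset.coe_erase]
    rw [← ih (I := insert y (I.erase e)) (by rwa [hcoe]) ?_]
    · rw [Finset.prod_insert (fun hc => hyI (Finset.mem_of_mem_erase hc)),
        ← Finset.prod_erase_mul I _ he'.1, mul_comm (xElt M Pm y)]
      refine h.prod_mul_xElt_eq ?_ ((hcl _ hI).1 he'.1) ((hcl _ hJ).1 hy.1) ?_ ?_
      · rw [Finset.coe_erase]
        exact Set.sdiff_subset.trans (hcl _ hI).1
      · rw [← Finset.coe_insert, Finset.insert_erase he'.1]
        exact (hcl _ hI).2
      · rw [Finset.coe_erase]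
        exact (hcl _ hyB).2
    · have : insert y (I.erase e) \ J = (I \ J).erase e := by
        rw [Finset.insert_sdiff_of_mem _ (by exact_mod_cast hy.1), Finset.erase_sdiff_comm]
      rw [this, Finset.card_erase_of_mem he, hn]
      rfl

/-- A basis of the center. -/
lemma exists_isBase : ∃ I : Finset α, (M.restrict Z).IsBase I ∧ (I : Set α) ⊆ Z ∧
    M.closure I = Z ∧ 0 < I.card ∧ ∀ J : Finset α, (J : Set α) ⊆ Z → M.closure J = Z →
      ∃ K ⊆ J, (M.restrict Z).IsBase K ∧ K.card = I.card := by
  classical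
  obtain ⟨B, hB⟩ := (M.restrict Z).exists_isBase
  have hBZ : B ⊆ Z := hB.subset_ground
  have hfin : B.Finite := M.ground_finite.subset (hBZ.trans h.center_subset)
  have hcl : M.closure B = Z := by
    rw [← h.closure_restrict hBZ, hB.closure_eq, Matroid.restrict_ground_eq]
  refine ⟨hfin.toFinset, by simpa using hB, by simpa using hBZ, by simpa using hcl, ?_, ?_⟩
  · rw [Finset.card_pos]
    exact h.nonempty_of_closure_eq (by simpa using hcl)
  · intro J hJ hJcl
    obtain ⟨K, hK⟩ := (M.restrict Z).exists_isBasis (J : Set α) hJ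
    have hKb : (M.restrict Z).IsBase K := by
      rw [Matroid.isBase_iff_indep_closure_eq]
      refine ⟨hK.indep, ?_⟩
      rw [hK.closure_eq_closure, h.closure_restrict hJ, hJcl, Matroid.restrict_ground_eq]
    have hKfin : K.Finite := J.finite_toSet.subset hK.subset
    refine ⟨hKfin.toFinset, ?_, by simpa using hKb, ?_⟩
    · intro x hx
      exact hK.subset (by simpa using hx)
    · rw [← Set.ncard_eq_toFinset_card K hKfin, ← Set.ncard_eq_toFinset_card B hfin]
      exact hKb.ncard_eq_ncard_of_isBase hB

end IsMatroidalFlip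

open Polynomial in
-- A nonzero multiple of q has degree at least that of q. The degree bound is asked only over
-- nontrivial R because over the zero ring every `natDegree` is 0.
lemma eq_zero_of_monic_mul_eq_C {R : Type*} [CommRing R] {q p : R[X]} (hq : q.Monic)
    (hdeg : Nontrivial R → 0 < q.natDegree) {b : R} (hqp : q * p = C b) : p = 0 := by
  by_contra hp
  have : Nontrivial R := Polynomial.nontrivial_iff.1 ⟨p, 0, hp⟩
  have h1 := hq.natDegree_mul' hp
  rw [hqp, natDegree_C] at h1
  have := hdeg this
  omega

namespace FlipMaps

variable (h : IsMatroidalFlip M Pm Pp Z) (f : FlipMaps M Pm Pp Z)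

include h

open Polynomial in
/-- The map `ι` is injective: it is split by a homomorphism to `A(M,𝓟₋)[X] / (L + (P))`, where
`P = ∏ (x_i - X)` over a basis of the center and `L` consists of the polynomials without constant
term with coefficients in the kernel of the map to `A(M_Z)`. -/
lemma ι_injective : Function.Injective f.ι := by
  classical
  obtain ⟨I, hIb, hIZ, hIcl, hIpos, hI⟩ := h.exists_isBase
  have hr := chowRel_chow h.filter_minus
  set L : Ideal (Chow M Pm)[X] := RingHom.ker (Polynomial.mapRingHom (f.link : Chow M Pm →+* FullChow (M.contract Z))) ⊓
    RingHom.ker (Polynomial.evalRingHom (0 : Chow M Pm)) with hL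
  have memL : ∀ q : (Chow M Pm)[X], q ∈ L ↔
      q.map (f.link : Chow M Pm →+* FullChow (M.contract Z)) = 0 ∧ q.eval 0 = 0 := fun q => Iff.rfl
  set poly : Finset α → (Chow M Pm)[X] := fun J => ∏ i ∈ J, (C (xElt M Pm i) - X) with hpoly
  have map_poly : ∀ J : Finset α, (J : Set α) ⊆ Z →
      (poly J).map (f.link : Chow M Pm →+* FullChow (M.contract Z)) = (C f.γ - X) ^ J.card := by
    intro J hJ
    rw [hpoly, Polynomial.map_prod]
    refine Finset.prod_eq_pow_card fun i hi => ?_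
    rw [Polynomial.map_sub, map_C, map_X, RingHom.coe_coe, f.link_xElt_center i (hJ hi)]
  have eval_poly : ∀ J : Finset α, (poly J).eval 0 = ∏ i ∈ J, xElt M Pm i := by
    intro J
    simp [hpoly, Polynomial.eval_prod]
  set K : Ideal (Chow M Pm)[X] := L ⊔ Ideal.span {poly I} with hK
  -- For two bases both polynomials map to (γ - X)^r over A(M_Z) and have the same constant term, so
  -- they differ by an element of L.
  have hbase : ∀ J : Finset α, (M.restrict Z).IsBase J → J.card = I.card → poly J ∈ K := by
    intro J hJ hcard
    have : poly J - poly I ∈ L := by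
      rw [memL, Polynomial.map_sub, map_poly J hJ.subset_ground, map_poly I hIZ, hcard, sub_self,
        eval_sub, eval_poly, eval_poly, h.prod_xElt_eq_of_isBase hJ hIb, sub_self]
      exact ⟨rfl, rfl⟩
    rw [← sub_add_cancel (poly J) (poly I)]
    exact K.add_mem (Ideal.mem_sup_left this)
      (Ideal.mem_sup_right (Ideal.subset_span rfl))
  set π := Ideal.Quotient.mkₐ ℂ K with hπ
  have hπ0 : ∀ q ∈ K, π q = 0 := fun q hq => Ideal.Quotient.eq_zero_iff_mem.2 hq
  set inc : Chow M Pm →ₐ[ℂ] (Chow M Pm)[X] ⧸ K := π.comp (Polynomial.CAlgHom) with hinc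
  have hinc' : ∀ a, inc a = π (C a) := fun a => rfl
  have hplus := h.chowRel_plus (hr.map h.filter_minus.finite (inc : Chow M Pm →+* (Chow M Pm)[X] ⧸ K)) (π X) ?_ ?_ ?_
  rotate_left
  · intro j hj
    rw [RingHom.coe_coe, hinc', ← map_mul]
    refine hπ0 _ (Ideal.mem_sup_left ((memL _).2 ⟨?_, by simp⟩))
    rw [Polynomial.map_mul, map_C, RingHom.coe_coe, f.link_xElt j hj, map_zero, zero_mul]
  · intro F hF hZF
    rw [RingHom.coe_coe, hinc', ← map_mul]
    refine hπ0 _ (Ideal.mem_sup_left ((memL _).2 ⟨?_, by simp⟩))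
    rw [Polynomial.map_mul, map_C, RingHom.coe_coe, f.link_xFlat_eq_zero F hF hZF, map_zero,
      zero_mul]
  · intro J hJ hJcl
    have : ∏ i ∈ J, ((inc : Chow M Pm →+* (Chow M Pm)[X] ⧸ K) (xElt M Pm i) - π X) = π (poly J) := by
      rw [hpoly, map_prod]
      exact Finset.prod_congr rfl fun i _ => (map_sub π _ _).symm
    rw [this]
    -- A spanning set contains a basis, whose polynomial divides that of the spanning set.
    obtain ⟨J', hJJ, hJ'b, hcard⟩ := hI J hJ hJcl
    exact hπ0 _ (K.mem_of_dvd (Finset.prod_dvd_prod_of_subset _ _ _ hJJ) (hbase J' hJ'b hcard))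
  have hsplit : (hplus.lift h.filter_plus).comp f.ι = inc := by
    obtain ⟨j, hj, hjZ⟩ := h.exists_notMem_center
    refine Chow.hom_ext_of_flats h.filter_minus hj ?_ ?_
    · rw [AlgHom.comp_apply, f.ι_xElt j ⟨hj, hjZ⟩, hplus.lift_xElt _ hj, if_neg hjZ, sub_zero]
      rfl
    · intro F hF
      rw [AlgHom.comp_apply, f.ι_xFlat F hF, hplus.lift_xFlat _ (h.minus_subset hF),
        if_neg (h.ne_center hF)]
      rfl
  rw [injective_iff_map_eq_zero]
  intro a ha
  have h0 : inc a = 0 := by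
    rw [← hsplit, AlgHom.comp_apply, ha, map_zero]
  have hmem : C a ∈ K := Ideal.Quotient.eq_zero_iff_mem.1 h0
  obtain ⟨l, hl, m, hm, hlm⟩ := Submodule.mem_sup.1 hmem
  obtain ⟨p, rfl⟩ := Ideal.mem_span_singleton'.1 hm
  rw [memL] at hl
  -- Over A(M_Z) the summand from L disappears, leaving a constant that is a multiple of (γ - X)^r.
  -- This is monic up to sign and r > 0, so the cofactor p maps to zero.
  have h1 := congrArg (Polynomial.map (f.link : Chow M Pm →+* FullChow (M.contract Z))) hlm
  rw [Polynomial.map_add, hl.1, zero_add, Polynomial.map_mul, map_poly I hIZ, map_C] at h1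
  have hp0 : p.map (f.link : Chow M Pm →+* FullChow (M.contract Z)) = 0 := by
    have hsgn : (X - C f.γ) ^ I.card * ((-1) ^ I.card *
        p.map (f.link : Chow M Pm →+* FullChow (M.contract Z))) =
        C ((f.link : Chow M Pm →+* FullChow (M.contract Z)) a) := by
      rw [← h1, ← neg_sub X (C f.γ), neg_pow (X - C f.γ)]
      ring
    have := eq_zero_of_monic_mul_eq_C ((monic_X_sub_C f.γ).pow I.card) (fun _ => by
      rw [(monic_X_sub_C f.γ).natDegree_pow, natDegree_X_sub_C, mul_one]
      exact hIpos) hsgn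
    have hu : ((-1 : (FullChow (M.contract Z))[X]) ^ I.card) * (-1) ^ I.card = 1 := by
      rw [← mul_pow]
      simp
    calc _ = ((-1 : (FullChow (M.contract Z))[X]) ^ I.card) * (((-1) ^ I.card) *
        p.map (f.link : Chow M Pm →+* FullChow (M.contract Z))) := by rw [← mul_assoc, hu, one_mul]
      _ = 0 := by rw [this, mul_zero]
  -- At X = 0 the summand from L disappears again, so a = p(0) x^I with p(0) in ker link.
  have h2 := congrArg (Polynomial.eval 0) hlm
  rw [eval_add, hl.2, zero_add, eval_mul, eval_poly, eval_C] at h2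
  rw [← h2]
  refine f.mul_prod_eq_zero h ?_ hIZ hIcl
  have h3 := congrArg (Polynomial.eval 0) hp0
  rw [eval_zero, ← map_zero (f.link : Chow M Pm →+* FullChow (M.contract Z)),
    eval_map_apply] at h3
  exact h3.trans (map_zero _)

end FlipMaps

end

/-! ### Exactness -/

variable {M : Matroid α} {Pm Pp : Set (Set α)} {Z : Set α}

namespace FlipMaps

variable (h : IsMatroidalFlip M Pm Pp Z) (f : FlipMaps M Pm Pp Z)

open Polynomial in
/-- Evaluation of polynomials over `A(M,𝓟₋)` at `x_Z`. -/
def evalCenter : (Chow M Pm)[X] →ₐ[ℂ] Chow M Pp :=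
  Polynomial.eval₂AlgHom f.ι (xFlat M Pp Z) fun _ => Commute.all _ _

open Polynomial in
lemma evalCenter_C (a : Chow M Pm) : f.evalCenter (C a) = f.ι a :=
  Polynomial.eval₂_C _ _

open Polynomial in
lemma evalCenter_X : f.evalCenter X = xFlat M Pp Z :=
  Polynomial.eval₂_X _ _

open Polynomial in
lemma θ_evalCenter_eq_zero {q : (Chow M Pm)[X]}
    (hq : q.map (f.link : Chow M Pm →+* FullChow (M.contract Z)) = 0) :
    f.θ (f.evalCenter q) = 0 := by
  have hcoeff : ∀ n, f.link (q.coeff n) = 0 := fun n => by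
    have := congrArg (fun p => p.coeff n) hq
    simpa using this
  rw [q.as_sum_range_C_mul_X_pow, map_sum, map_sum]
  refine Finset.sum_eq_zero fun n _ => ?_
  rw [map_mul, map_mul, evalCenter_C, f.θ_ι, hcoeff, TensorProduct.tmul_zero, zero_mul]

variable [M.Finite]

include h

lemma ι_mem_gradedPiece {s : ℕ} {x : Chow M Pm} (hx : x ∈ gradedPiece M Pm s) :
    f.ι x ∈ gradedPiece M Pp s := by
  refine map_mem_of_mem_gradedPiece h.filter_minus f.ι (gradedPiece M Pp) one_mem_gradedPiece
    (fun s t a ha b hb => mul_mem_gradedPiece ha hb) ?_ ?_ hx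
  · intro i hi
    by_cases hiZ : i ∈ Z
    · rw [f.ι_xElt_center i hiZ]
      exact Submodule.add_mem _ (xElt_mem_gradedPiece i) (xFlat_mem_gradedPiece Z)
    · rw [f.ι_xElt i ⟨hi, hiZ⟩]
      exact xElt_mem_gradedPiece i
  · intro F hF
    rw [f.ι_xFlat F hF]
    exact xFlat_mem_gradedPiece F

lemma θ_mem_tensorPiece {s : ℕ} {y : Chow M Pp} (hy : y ∈ gradedPiece M Pp s) :
    f.θ y ∈ tensorPiece (M.restrict Z) (M.contract Z) ∅ (properFlats (M.contract Z)) s := by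
  have hright : ∀ b ∈ gradedPiece (M.contract Z) (properFlats (M.contract Z)) 1,
      (1 : Chow (M.restrict Z) ∅) ⊗ₜ[ℂ] b ∈
        tensorPiece (M.restrict Z) (M.contract Z) ∅ (properFlats (M.contract Z)) 1 := by
    intro b hb
    exact tmul_mem_tensorPiece one_mem_gradedPiece hb (zero_add 1)
  have hleft : ∀ i, xElt (M.restrict Z) ∅ i ⊗ₜ[ℂ] (1 : FullChow (M.contract Z)) ∈
      tensorPiece (M.restrict Z) (M.contract Z) ∅ (properFlats (M.contract Z)) 1 := by
    intro i
    exact tmul_mem_tensorPiece (xElt_mem_gradedPiece i) one_mem_gradedPiece (add_zero 1)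
  refine map_mem_of_mem_gradedPiece h.filter_plus f.θ
    (tensorPiece (M.restrict Z) (M.contract Z) ∅ (properFlats (M.contract Z))) ?_ ?_ ?_ ?_ hy
  · rw [Algebra.TensorProduct.one_def]
    exact tmul_mem_tensorPiece one_mem_gradedPiece one_mem_gradedPiece (zero_add 0)
  · exact fun s t a ha b hb => mul_mem_tensorPiece ha hb
  · intro i hi
    by_cases hiZ : i ∈ Z
    · rw [f.θ_xElt_center i hiZ]
      exact hleft i
    · rw [f.θ_xElt i ⟨hi, hiZ⟩]
      exact Submodule.zero_mem _
  · intro F hF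
    rcases h.mem_plus_cases hF with rfl | hF'
    · obtain ⟨i₀, hi₀⟩ := h.center_mem_properFlats.2.1
      rw [f.θ_center i₀ hi₀]
      exact Submodule.sub_mem _ (hright _ f.γ_mem) (hleft _)
    · rw [← f.ι_xFlat F hF', f.θ_ι]
      by_cases hZF : Z ⊆ F
      · rw [f.link_xFlat F hF' hZF]
        exact hright _ (xFlat_mem_gradedPiece _)
      · rw [f.link_xFlat_eq_zero F hF' hZF, TensorProduct.tmul_zero]
        exact Submodule.zero_mem _

/-- For i in Z the generator x_i of A₊ is ι(x_i) - x_Z. -/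
lemma evalCenter_surjective : Function.Surjective f.evalCenter := by
  intro y
  refine Chow.eq_top_of_mem h.filter_plus f.evalCenter.range ?_ ?_ y
  · intro i hi
    by_cases hiZ : i ∈ Z
    · refine ⟨Polynomial.C (xElt M Pm i) - Polynomial.X, ?_⟩
      exact (map_sub f.evalCenter _ _).trans (by
        rw [evalCenter_C, evalCenter_X, f.ι_xElt_center i hiZ, add_sub_cancel_right])
    · exact ⟨Polynomial.C (xElt M Pm i), (f.evalCenter_C _).trans (f.ι_xElt i ⟨hi, hiZ⟩)⟩
  · intro F hF
    rcases h.mem_plus_cases hF with rfl | hF'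
    · exact ⟨Polynomial.X, f.evalCenter_X⟩
    · exact ⟨Polynomial.C (xFlat M Pm F), (f.evalCenter_C _).trans (f.ι_xFlat F hF')⟩

variable [M.Loopless]

open Polynomial in
/-- Every element of `A(M,𝓟₊)` is a polynomial in `x_Z` of degree less than the rank of the
center. -/
lemma exists_natDegree_lt {I : Finset α} (hI : (I : Set α) ⊆ Z) (hcl : M.closure I = Z)
    (hpos : 0 < I.card) (y : Chow M Pp) :
    ∃ q : (Chow M Pm)[X], q.natDegree < I.card ∧ f.evalCenter q = y := by
  obtain ⟨q, rfl⟩ := f.evalCenter_surjective h y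
  rcases subsingleton_or_nontrivial (Chow M Pm) with hs | hn
  · refine ⟨0, by simpa using hpos, ?_⟩
    rw [Subsingleton.elim q 0]
  -- At x_Z its factors become -x_i, whose product vanishes in A₊ because I spans Z. Division by
  -- this monic polynomial lowers the degree.
  set P : (Chow M Pm)[X] := ∏ i ∈ I, (X - C (xElt M Pm i)) with hP
  have hmonic : P.Monic := monic_prod_of_monic _ _ fun i _ => monic_X_sub_C _
  have hdeg : P.natDegree = I.card := by
    rw [hP, natDegree_prod_of_monic _ _ fun i _ => monic_X_sub_C _]
    simp
  have hP0 : f.evalCenter P = 0 := by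
    rw [hP, map_prod]
    have : ∀ i ∈ I, f.evalCenter (X - C (xElt M Pm i)) = -1 * xElt M Pp i := by
      intro i hi
      rw [map_sub, evalCenter_C, evalCenter_X, f.ι_xElt_center i (hI hi)]
      ring
    rw [Finset.prod_congr rfl this, Finset.prod_mul_distrib,
      (chowRel_chow h.filter_plus).prod_elt I (hI.trans h.center_subset)
        (Or.inr (hcl ▸ h.center_mem)), mul_zero]
  refine ⟨q %ₘ P, ?_, ?_⟩
  · rw [← hdeg]
    refine natDegree_modByMonic_lt q hmonic fun h1 => ?_
    rw [h1, natDegree_one] at hdeg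
    omega
  · conv_rhs => rw [← modByMonic_add_div q P, map_add, map_mul, hP0, zero_mul, add_zero]

open Polynomial in
-- The truncation at X^r is allowed because a set spanning Z has at least r elements. The map
-- detects that the powers of x_i below the r-th are independent over A(M_Z).
lemma exists_detector {I : Finset α} (hcard : ∀ J : Finset α, (J : Set α) ⊆ Z →
      M.closure J = Z → I.card ≤ J.card) :
    ∃ ξ : FlipTensor M Z →ₐ[ℂ] (FullChow (M.contract Z))[X] ⧸
        (Ideal.span {(X : (FullChow (M.contract Z))[X]) ^ I.card}),
      (∀ b, ξ (1 ⊗ₜ b) = Ideal.Quotient.mk _ (C b)) ∧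
      ∀ i ∈ Z, ξ (xElt (M.restrict Z) ∅ i ⊗ₜ 1) = Ideal.Quotient.mk _ X := by
  have := h.finite_restrict
  have := h.loopless_restrict
  set T := Ideal.span {(X : (FullChow (M.contract Z))[X]) ^ I.card}
  have hr : ChowRel (M.restrict Z) ∅ (fun _ => Ideal.Quotient.mk T X) (fun _ => 0) := by
    refine h.chowRel_restrict (fun _ _ _ _ => rfl) fun J hJ hcl => ?_
    rw [Finset.prod_const, ← map_pow, Ideal.Quotient.eq_zero_iff_mem, Ideal.mem_span_singleton]
    exact pow_dvd_pow _ (hcard J hJ hcl)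
  refine ⟨Algebra.TensorProduct.lift (hr.lift (isOrderFilter_empty _))
    ((Ideal.Quotient.mkₐ ℂ T).comp Polynomial.CAlgHom) (fun _ _ => Commute.all _ _), ?_, ?_⟩
  · intro b
    rw [Algebra.TensorProduct.lift_tmul, map_one, one_mul]
    rfl
  · intro i hi
    rw [Algebra.TensorProduct.lift_tmul, map_one, mul_one, hr.lift_xElt _ hi]

open Polynomial in
/-- Elements whose image under `θ` lies in `1 ⊗ A(M_Z)` come from `A(M,𝓟₋)`. -/
lemma exists_ι_eq {y : Chow M Pp} {b : FullChow (M.contract Z)} (hy : f.θ y = 1 ⊗ₜ b) :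
    ∃ a, f.ι a = y := by
  obtain ⟨I, hIb, hIZ, hIcl, hIpos, hI⟩ := h.exists_isBase
  obtain ⟨q, hqdeg, rfl⟩ := f.exists_natDegree_lt h hIZ hIcl hIpos y
  obtain ⟨ξ, hξ1, hξ2⟩ := exists_detector h (I := I) (fun J hJ hcl => by
    obtain ⟨K, hKJ, -, hK⟩ := hI J hJ hcl
    exact hK ▸ Finset.card_le_card hKJ)
  obtain ⟨i₀, hi₀⟩ := h.center_mem_properFlats.2.1
  set l : Chow M Pm →+* FullChow (M.contract Z) := (f.link : Chow M Pm →+* FullChow (M.contract Z)) with hl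
  -- This is the image of x_Z under θ followed by ξ.
  set s : (FullChow (M.contract Z))[X] := C f.γ - X with hs
  have hcomp : ∀ p : (Chow M Pm)[X], ξ (f.θ (f.evalCenter p)) =
      Ideal.Quotient.mk _ ((p.map l).comp s) := by
    intro p
    induction p using Polynomial.induction_on' with
    | add p q hp hq => rw [map_add, map_add, map_add, hp, hq, Polynomial.map_add, add_comp, map_add]
    | monomial n a =>
      rw [← C_mul_X_pow_eq_monomial, map_mul, map_mul, map_mul, map_pow, map_pow, map_pow,
        evalCenter_C, evalCenter_X, f.θ_ι, hξ1, f.θ_center i₀ hi₀, map_sub, hξ1, hξ2 i₀ hi₀,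
        Polynomial.map_mul, Polynomial.map_pow, map_C, map_X, mul_comp, C_comp, X_pow_comp,
        map_mul, map_pow, hs, map_sub]
      rfl
  have hmem : (q.map l).comp s - C b ∈
      Ideal.span {(X : (FullChow (M.contract Z))[X]) ^ I.card} := by
    rw [← Ideal.Quotient.eq_zero_iff_mem, map_sub, ← hcomp, hy, hξ1, sub_self]
  have hdeg : ((q.map l).comp s - C b).natDegree < I.card := by
    refine (natDegree_sub_le _ _).trans_lt (max_lt ?_ (by rwa [natDegree_C]))
    refine natDegree_comp_le.trans_lt ?_
    have h1 : s.natDegree ≤ 1 := (natDegree_sub_le _ _).trans (max_le (by simp) natDegree_X_le)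
    calc _ ≤ q.natDegree * 1 := Nat.mul_le_mul natDegree_map_le h1
      _ < I.card := by rwa [mul_one]
  -- A polynomial of degree less than r that is divisible by X^r is zero.
  have hzero : (q.map l).comp s - C b = 0 := by
    rw [Ideal.mem_span_singleton, X_pow_dvd_iff] at hmem
    ext n
    rw [coeff_zero]
    by_cases hn : n < I.card
    · exact hmem n hn
    · exact coeff_eq_zero_of_natDegree_lt (by omega)
  -- The substitution X ↦ γ - X is an involution, so it can be undone to make the image of q
  -- constant.
  have hss : s.comp s = X := by
    rw [hs, sub_comp, C_comp, X_comp, sub_sub_cancel]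
  have hq : q.map l = C b := by
    have := congrArg (fun p => p.comp s) (sub_eq_zero.1 hzero)
    simpa only [comp_assoc, hss, comp_X, C_comp] using this
  have hdiv : (q.divX).map l = 0 := by
    ext n
    have := congrArg (fun p => p.coeff (n + 1)) hq
    simpa [coeff_C] using this
  -- The remaining part of q is X times a polynomial over ker link. Its cofactor evaluates into ker
  -- θ, which x_Z annihilates.
  refine ⟨q.coeff 0, ?_⟩
  conv_rhs => rw [← divX_mul_X_add q]
  rw [map_add, map_mul, evalCenter_X, evalCenter_C,
    f.mul_center_eq_zero h (f.θ_evalCenter_eq_zero hdiv), zero_add]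

/-- Generators are hit: x_i ⊗ 1 by x_i, and 1 ⊗ x_G by ι(x_{G ∪ Z}); the x_i of the contraction are
zero. -/
lemma θ_surjective : Function.Surjective f.θ := by
  have := h.finite_restrict
  have := h.loopless_restrict
  have := h.loopless_contract
  have hr : ∀ b, (1 : Chow (M.restrict Z) ∅) ⊗ₜ[ℂ] b ∈ f.θ.range := by
    intro b
    refine Chow.eq_top_of_mem (isOrderFilter_properFlats (M.contract Z))
      (f.θ.range.comap Algebra.TensorProduct.includeRight) ?_ ?_ b
    · intro i hi
      rw [h.xElt_contract_eq_zero hi]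
      exact Subalgebra.zero_mem _
    · intro G hG
      obtain ⟨hGm, hGd⟩ := h.union_mem hG
      refine ⟨f.ι (xFlat M Pm (G ∪ Z)), ?_⟩
      refine (f.θ_ι _).trans ?_
      rw [f.link_xFlat _ hGm Set.subset_union_right, hGd]
      rfl
  have hl : ∀ a, a ⊗ₜ[ℂ] (1 : FullChow (M.contract Z)) ∈ f.θ.range := by
    intro a
    refine Chow.eq_top_of_mem (isOrderFilter_empty (M.restrict Z))
      (f.θ.range.comap Algebra.TensorProduct.includeLeft) ?_ ?_ a
    · intro i hi
      exact ⟨xElt M Pp i, f.θ_xElt_center i hi⟩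
    · intro F hF
      exact absurd hF (Set.notMem_empty F)
  intro t
  change t ∈ f.θ.range
  induction t using TensorProduct.induction_on with
  | zero => exact Subalgebra.zero_mem _
  | add x y hx hy => exact Subalgebra.add_mem _ hx hy
  | tmul a b =>
    have : a ⊗ₜ[ℂ] b = a ⊗ₜ[ℂ] (1 : FullChow (M.contract Z)) * (1 : Chow (M.restrict Z) ∅) ⊗ₜ b := by
      rw [Algebra.TensorProduct.tmul_mul_tmul, mul_one, one_mul]
    rw [this]
    exact Subalgebra.mul_mem _ (hl a) (hr b)

end FlipMaps

/-- The augmentation of `A(M^Z, ∅)`. -/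
lemma IsMatroidalFlip.exists_augmentation [M.Finite] [M.Loopless] (h : IsMatroidalFlip M Pm Pp Z) :
    ∃ ε : Chow (M.restrict Z) ∅ →ₐ[ℂ] ℂ, ∀ i ∈ Z, ε (xElt (M.restrict Z) ∅ i) = 0 := by
  have := h.finite_restrict
  have := h.loopless_restrict
  have hr : ChowRel (M.restrict Z) ∅ (fun _ => (0 : ℂ)) (fun _ => 0) := by
    refine h.chowRel_restrict (fun _ _ _ _ => rfl) fun J hJ hcl => ?_
    obtain ⟨i, hi⟩ := h.nonempty_of_closure_eq hcl
    exact Finset.prod_eq_zero hi rfl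
  exact ⟨hr.lift (isOrderFilter_empty _), fun i hi => hr.lift_xElt _ hi⟩

end FlipChow

end

/-! ### Assembly of the short exact sequence. -/

theorem corollary6p3 {α : Type*} (M : Matroid α) [M.Finite] [M.Loopless]
    (Pm Pp : Set (Set α)) (Z : Set α) (hflip : FlipChow.IsMatroidalFlip M Pm Pp Z) :
    ∃ (ι : FlipChow.Chow M Pm →ₐ[ℂ] FlipChow.Chow M Pp)
      (θ : FlipChow.Chow M Pp →ₐ[ℂ] FlipChow.FlipTensor M Z)
      (g : FlipChow.Chow M Pp →ₗ[ℂ] FlipChow.FlipTerm M Z),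
      -- the ring homomorphism `ι`
      (∀ i ∈ Z, ι (FlipChow.xElt M Pm i) = FlipChow.xElt M Pp i + FlipChow.xFlat M Pp Z) ∧
      (∀ i ∈ M.E \ Z, ι (FlipChow.xElt M Pm i) = FlipChow.xElt M Pp i) ∧
      (∀ F ∈ Pm, ι (FlipChow.xFlat M Pm F) = FlipChow.xFlat M Pp F) ∧
      -- the ring homomorphism `θ`, the restriction to the exceptional part
      (∀ i ∈ Z, θ (FlipChow.xElt M Pp i) = FlipChow.xElt (M.restrict Z) ∅ i ⊗ₜ[ℂ] 1) ∧
      (∀ i ∈ M.E \ Z, θ (FlipChow.xElt M Pp i) = 0) ∧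
      (∀ F ∈ Pp, Z ⊂ F → θ (FlipChow.xFlat M Pp F) =
        1 ⊗ₜ[ℂ] FlipChow.xFlat (M.contract Z) (FlipChow.properFlats (M.contract Z)) (F \ Z)) ∧
      (∀ F ∈ Pp, ¬ Z ⊆ F → θ (FlipChow.xFlat M Pp F) = 0) ∧
      -- `g` is `θ` modulo `1 ⊗ A(M_Z)`
      (∀ y, ∃ b : FlipChow.FullChow (M.contract Z),
        θ y = FlipChow.flipInclusion M Z (g y) + 1 ⊗ₜ[ℂ] b) ∧
      -- both maps preserve degrees
      (∀ s, ∀ x ∈ FlipChow.gradedPiece M Pm s, ι x ∈ FlipChow.gradedPiece M Pp s) ∧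
      (∀ s, ∀ y ∈ FlipChow.gradedPiece M Pp s, g y ∈ FlipChow.flipTermPiece M Z s) ∧
      -- the sequence is short exact
      Function.Injective ι ∧ Function.Exact ι g ∧ Function.Surjective g := by
  obtain ⟨f⟩ := hflip.nonempty_flipMaps
  have := hflip.finite_restrict
  have := hflip.loopless_restrict
  obtain ⟨ε, hε⟩ := hflip.exists_augmentation
  have hP := FlipChow.isOrderFilter_empty (M.restrict Z)
  have hε' : ∀ F ∈ (∅ : Set (Set α)), ε (FlipChow.xFlat (M.restrict Z) ∅ F) = 0 :=
    fun F hF => absurd hF (Set.notMem_empty F)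
  obtain ⟨p, hp⟩ := FlipChow.exists_projection hP hε hε'
  -- The projection p removes the augmentation, so `pt` removes a summand in 1 ⊗ A(M_Z); g is `pt`
  -- after θ.
  set pt : FlipChow.FlipTensor M Z →ₗ[ℂ] FlipChow.FlipTerm M Z :=
    p.rTensor (FlipChow.FullChow (M.contract Z)) with hpt
  have pt_tmul : ∀ a b, pt (a ⊗ₜ b) = p a ⊗ₜ b := fun a b => rfl
  have hp1 : p 1 = 0 := Subtype.ext (by rw [hp, map_one, map_one, sub_self]; rfl)
  have hdecomp : ∀ t, ∃ b : FlipChow.FullChow (M.contract Z),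
      t = FlipChow.flipInclusion M Z (pt t) + 1 ⊗ₜ[ℂ] b := by
    intro t
    induction t using TensorProduct.induction_on with
    | zero => exact ⟨0, by rw [map_zero, map_zero, TensorProduct.tmul_zero, zero_add]⟩
    | add x y hx hy =>
      obtain ⟨b, hb⟩ := hx
      obtain ⟨c, hc⟩ := hy
      refine ⟨b + c, ?_⟩
      rw [map_add, map_add, TensorProduct.tmul_add]
      nth_rewrite 1 [hb, hc]
      abel
    | tmul a b =>
      refine ⟨ε a • b, ?_⟩
      have : FlipChow.flipInclusion M Z (pt (a ⊗ₜ b)) = (p a : FlipChow.Chow _ _) ⊗ₜ b := rfl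
      rw [this, hp, ← TensorProduct.smul_tmul, ← Algebra.algebraMap_eq_smul_one,
        ← TensorProduct.add_tmul, sub_add_cancel]
  refine ⟨f.ι, f.θ, pt.comp f.θ.toLinearMap, f.ι_xElt_center, f.ι_xElt, f.ι_xFlat,
    f.θ_xElt_center, f.θ_xElt, ?_, ?_, fun y => hdecomp (f.θ y),
    fun s x hx => f.ι_mem_gradedPiece hflip hx, ?_, f.ι_injective hflip, ?_, ?_⟩
  · intro F hF hZF
    have hF' := (hflip.mem_plus_cases hF).resolve_left hZF.ne'
    rw [← f.ι_xFlat F hF', f.θ_ι, f.link_xFlat F hF' hZF.1]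
  · intro F hF hZF
    have hF' := (hflip.mem_plus_cases hF).resolve_left fun hc => hZF hc.ge
    rw [← f.ι_xFlat F hF', f.θ_ι, f.link_xFlat_eq_zero F hF' hZF, TensorProduct.tmul_zero]
  · intro s y hy
    have hle : FlipChow.tensorPiece (M.restrict Z) (M.contract Z) ∅
        (FlipChow.properFlats (M.contract Z)) s ≤ (FlipChow.flipTermPiece M Z s).comap pt := by
      rw [FlipChow.tensorPiece, Submodule.span_le]
      rintro _ ⟨s₁, s₂, a, b, hs, ha, hb, rfl⟩
      rw [SetLike.mem_coe, Submodule.mem_comap, pt_tmul]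
      -- In degree zero the left factor is a scalar, which p kills; in positive degree p fixes it.
      rcases Nat.eq_zero_or_pos s₁ with rfl | hs₁
      · have : p a = 0 := Subtype.ext (by
          rw [hp, ← FlipChow.eq_augmentation hP hε hε' ha, sub_self]; rfl)
        rw [this, TensorProduct.zero_tmul]
        exact Submodule.zero_mem _
      · refine Submodule.subset_span ⟨s₁, s₂, p a, b, hs₁, hs, ?_, hb, rfl⟩
        rwa [hp, FlipChow.augmentation_eq_zero hP hε hε' hs₁ ha, map_zero, sub_zero]
    exact hle (f.θ_mem_tensorPiece hflip hy)
  · intro y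
    constructor
    · intro hy
      obtain ⟨b, hb⟩ := hdecomp (f.θ y)
      -- Being in the kernel of g means that θ y lies in 1 ⊗ A(M_Z).
      rw [show pt (f.θ y) = 0 from hy, map_zero, zero_add] at hb
      exact f.exists_ι_eq hflip hb
    · rintro ⟨a, rfl⟩
      change pt (f.θ (f.ι a)) = 0
      rw [f.θ_ι, pt_tmul, hp1, TensorProduct.zero_tmul]
  · have hps : Function.Surjective p := by
      intro a
      refine ⟨a, Subtype.ext ?_⟩
      rw [hp, FlipChow.augmentation_eq_zero_of_mem_positivePart hP hε hε' a.2, map_zero, sub_zero]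
    exact (LinearMap.rTensor_surjective _ hps).comp (f.θ_surjective hflip)
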